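/- Let $d\ge 2$ be an integer, $\hbar>0$, $\lambda\in\mathbb{R}\setminus\{0\}$, and let $\mathbb{H}^d=\{u\in\mathbb{R}^d:|u|<1\}$ be the ball model of hyperbolic space. Let ${\bf M}(a;b;z)=\sum_{n\ge 0}\frac{(a)_n}{\Gamma(b+n)\,n!}z^n$ be Olver's (regularized) confluent hypergeometric function, and for $x>1$ let $$P_\nu^{\mu}(x)=\Big(\frac{x+1}{x-1}\Big)^{\mu/2}\,{\bf F}\Big(\nu+1,-\nu;1-\mu;\frac{1-x}{2}\Big)$$ be the associated Legendre function of the first kind, where ${\bf F}(a,b;c;z)={}_2F_1(a,b;c;z)/\Gamma(c)$ is the regularized Gauss hypergeometric function, analytically continued to $z<0$. Put $c_{\hbar,\lambda}=|\lambda|^{\frac d2-1}\hbar^{\frac d2}\sqrt{2\pi}$ and define, for $\theta\in\mathbb{S}^{d-1}$, the plane waves $$\psi_{\hbar,\lambda}(x;\theta)=c_{\hbar,\lambda}\,e^{\frac{i}{\hbar^2\lambda}x\cdot\theta}\,{\bf M}\Big(i\lambda;\tfrac{d-1}{2};\tfrac{i}{\hbar^2\lambda}(|x|-x\cdot\theta)\Big)\quad(x\in\mathbb{R}^d),\qquad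 e_\lambda(u;\theta)=\Big(\frac{1-|u|^2}{|u-\theta|^2}\Big)^{\frac{d-1}{2}-i\lambda}\quad(u\in\mathbb{H}^d)$$ of the attractive Coulomb operator $-\frac{\hbar^2}{2}\Delta-\frac1{|x|}$ at energy $\frac{1}{2\hbar^2\lambda^2}$ and of hyperbolic space, respectively. For $f\in L^2(\mathbb{S}^{d-1})$ (with surface measure $d\theta$) define the Poisson operators $$P_{\widehat H_\hbar}(\hbar,\lambda)[f](x)=\int_{\mathbb{S}^{d-1}}\psi_{\hbar,\lambda}(x;\theta)f(\theta)\,d\theta,\qquad P_{\mathbb{H}^d}(\lambda)[f](u)=\int_{\mathbb{S}^{d-1}}e_{\lambda}(u;\theta)f(\theta)\,d\theta .$$ Then for every $\ell\in\mathbb{Z}_{\ge0}$ and every spherical harmonic $Y$ of degree $\ell$ on $\mathbb{S}^{d-1}$ (the restriction to the sphere of a complex homogeneous harmonic polynomial of degree $\ell$; in particular for every member $Y_\ell^{\boldsymbol m}$ of an orthonormal basis of these), both integrals with $f=Y$ converge absolutely for all $x\in\mathbb{R}^d$ and $u\in\mathbb{H}^d$, and the following hold. (1) For every $x=|x|\omega\in\mathbb{R}^d$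 with $\omega\in\mathbb{S}^{d-1}$, $$P_{\widehat H_\hbar}(\hbar,\lambda)[Y](x)=\frac{c_{\hbar,\lambda}2^{d-1}\pi^{\frac{d-1}{2}}\Gamma(\frac{d-1}{2}+\ell-i\lambda)}{\Gamma(\frac{d-1}{2}-i\lambda)}\Big(\frac{2i|x|}{\hbar^2\lambda}\Big)^{\ell}e^{\frac{i|x|}{\hbar^2\lambda}}\,{\bf M}\Big(\tfrac{d-1}{2}+\ell-i\lambda;\,d-1+2\ell;\,-\tfrac{2i|x|}{\hbar^2\lambda}\Big)Y(\omega).$$ (2) For every $u=|u|\omega\in\mathbb{H}^d$ with $u\neq0$ and $\omega\in\mathbb{S}^{d-1}$, $$P_{\mathbb{H}^d}(\lambda)[Y](u)=(2\pi)^{\frac d2}\,\frac{\Gamma(\frac{d-1}{2}-i\lambda+\ell)}{\Gamma(\frac{d-1}{2}-i\lambda)}\Big(\frac{2|u|}{1-|u|^2}\Big)^{1-\frac d2}P_{-\frac12+i\lambda}^{-(\frac d2-1+\ell)}\Big(\frac{1+|u|^2}{1-|u|^2}\Big)Y(\omega),$$ and $P_{\mathbb{H}^d}(\lambda)[Y]$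 is continuous on $\mathbb{H}^d$, so that at $u=0$ the formula holds as a limit. -/

import Mathlib

open MeasureTheory Filter Topology

noncomputable section

/-- The unit sphere `𝕊^{d-1} ⊆ ℝ^d`. -/
abbrev USphere (d : ℕ) : Type :=
  Metric.sphere (0 : EuclideanSpace ℝ (Fin d)) 1

/-- The ball model of hyperbolic space `ℍ^d = {u ∈ ℝ^d : |u| < 1}`. -/
abbrev HypSpace (d : ℕ) : Type :=
  Metric.ball (0 : EuclideanSpace ℝ (Fin d)) 1

/-- The (unnormalised) surface measure `dθ` on `𝕊^{d-1}`. -/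
def surfaceMeasure (d : ℕ) : Measure (USphere d) :=
  (volume : Measure (EuclideanSpace ℝ (Fin d))).toSphere

instance (d : ℕ) : IsFiniteMeasure (surfaceMeasure d) := by
  unfold surfaceMeasure; infer_instance

/-- `L²(𝕊^{d-1})`. -/
abbrev L2Sphere (d : ℕ) : Type :=
  Lp ℂ 2 (surfaceMeasure d)

/-- `Y : 𝕊^{d-1} → ℂ` is a spherical harmonic of degree `ℓ`: the restriction to the sphere of a
homogeneous harmonic polynomial of degree `ℓ` with complex coefficients. -/
def IsSphericalHarmonic (d ℓ : ℕ) (Y : C(USphere d, ℂ)) : Prop :=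
  ∃ p : MvPolynomial (Fin d) ℂ, p.IsHomogeneous ℓ ∧
    ∑ i, MvPolynomial.pderiv i (MvPolynomial.pderiv i p) = 0 ∧
    ∀ θ : USphere d, Y θ = MvPolynomial.eval (fun i => ((θ.1 i : ℝ) : ℂ)) p

/-- The class in `L²(𝕊^{d-1})` of a continuous function on the sphere. -/
def toL2Sphere (d : ℕ) (Y : C(USphere d, ℂ)) : L2Sphere d :=
  ContinuousMap.toLp 2 (surfaceMeasure d) ℂ Y

/-- Olver's regularised confluent hypergeometric function
`𝐌(a; b; z) = ∑ₙ (a)ₙ zⁿ / (Γ(b + n) n!)`, an entire function of `a`, `b` and `z`. -/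
def olverM (a b z : ℂ) : ℂ :=
  Complex.regularizedHGFun {a} {b} z

/-- The regularised Gauss hypergeometric function `𝐅(a, b; c; z) = ₂F₁(a, b; c; z) / Γ(c)` (principal
branch): for `|z| < 1` it is the sum of the series `∑ₙ (a)ₙ (b)ₙ zⁿ / (Γ(c + n) n!)`, and otherwise
it is continued analytically by Pfaff's formula
`𝐅(a, b; c; z) = (1 - z)^(-a) 𝐅(a, c - b; c; z / (z - 1))`, valid on the half-plane `Re z < 1/2`. It is
used below for real `z < 0` only. -/
def olverF (a b c z : ℂ) : ℂ :=
  open Classical in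
  if ‖z‖ < 1 then Complex.regularizedGaussHGFun a b c z
  else (1 - z) ^ (-a) * Complex.regularizedGaussHGFun a (c - b) c (z / (z - 1))

/-- The associated Legendre function of the first kind `P_ν^μ(x)` on the interval `1 < x < ∞`:
`P_ν^μ(x) = ((x + 1) / (x - 1))^(μ / 2) 𝐅(ν + 1, -ν; 1 - μ; (1 - x) / 2)`. -/
def legendreP (μ ν : ℂ) (x : ℝ) : ℂ :=
  (((x + 1) / (x - 1) : ℝ) : ℂ) ^ (μ / 2) *
    olverF (ν + 1) (-ν) (1 - μ) (((1 - x) / 2 : ℝ) : ℂ)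

/-- The normalising constant `c_{ħ,λ} = |λ|^{d/2-1} ħ^{d/2} √(2π)`. -/
def coulombConst (d : ℕ) (hbar lam : ℝ) : ℝ :=
  |lam| ^ ((d : ℝ) / 2 - 1) * hbar ^ ((d : ℝ) / 2) * √(2 * Real.pi)

/-- The perturbed plane wave of the attractive Coulomb operator,
`ψ_{ħ,λ}(x; θ) = c_{ħ,λ} exp(i x·θ / (ħ²λ)) 𝐌(iλ; (d-1)/2; i (|x| - x·θ) / (ħ²λ))`. -/
def coulombPlaneWave (d : ℕ) (hbar lam : ℝ) (x : EuclideanSpace ℝ (Fin d)) (θ : USphere d) : ℂ :=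
  (coulombConst d hbar lam : ℂ) *
    Complex.exp (Complex.I * ((inner ℝ x θ.1 / (hbar ^ 2 * lam) : ℝ) : ℂ)) *
    olverM (Complex.I * lam) (((d : ℂ) - 1) / 2)
      (Complex.I * (((‖x‖ - inner ℝ x θ.1) / (hbar ^ 2 * lam) : ℝ) : ℂ))

/-- The hyperbolic plane wave `e_λ(u; θ) = ((1 - |u|²) / |u - θ|²)^{(d-1)/2 - iλ}`. -/
def hyperbolicPlaneWave (d : ℕ) (lam : ℝ) (u : HypSpace d) (θ : USphere d) : ℂ :=
  (((1 - ‖u.1‖ ^ 2) / ‖u.1 - θ.1‖ ^ 2 : ℝ) : ℂ) ^ (((d : ℂ) - 1) / 2 - Complex.I * lam)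

/-- The Coulomb Poisson operator `f ↦ (x ↦ ∫_{𝕊^{d-1}} ψ_{ħ,λ}(x; θ) f(θ) dθ)` on `L²(𝕊^{d-1})`. -/
def coulombPoisson (d : ℕ) (hbar lam : ℝ) (f : L2Sphere d) (x : EuclideanSpace ℝ (Fin d)) : ℂ :=
  ∫ θ, coulombPlaneWave d hbar lam x θ * f θ ∂(surfaceMeasure d)

/-- The hyperbolic Poisson operator `f ↦ (u ↦ ∫_{𝕊^{d-1}} e_λ(u; θ) f(θ) dθ)` on `L²(𝕊^{d-1})`. -/
def hyperbolicPoisson (d : ℕ) (lam : ℝ) (f : L2Sphere d) (u : HypSpace d) : ℂ :=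
  ∫ θ, hyperbolicPlaneWave d lam u θ * f θ ∂(surfaceMeasure d)

end

open MeasureTheory Filter Topology

noncomputable section

/-! Both plane waves depend on `θ` only through `t = ω · θ`, so this is a Funk–Hecke computation:
expand the kernel in powers of a suitable variable, integrate term by term against `Y`, and
recognise the resulting series.

The moments of `t ^ n` against `Y` come from the Gaussian. If `p` is the harmonic form behind `Y`,
integration by parts reduces the Gaussian integral of `(ω · y) ^ n p(y)` to lower powers and to `∂_ω
p`, which is again harmonic. The recursion closes by Euler's identity (`gaussInt_linForm_pow_mul`),
and polar coordinates carry the result to the sphere (`IsSphericalHarmonic.integral_inner_pow`). The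
moments vanish unless `n = ℓ + 2k`.

Coulomb: Kummer's transformation turns the plane wave into a phase depending only on `|x|` times an
`olverM` series in `t - 1`. The moments of `(t - 1) ^ n` satisfy a two-term recursion, because zonal
polynomials of the form `(Δ + ℓ(ℓ + d - 2)) q` are orthogonal to `Y`
(`IsSphericalHarmonic.zonalPairing_gegenbauerOp`). Their closed form contains `Γ((d-1)/2 + n) n!`,
which cancels the denominator of the series and leaves another `olverM` series.

Hyperbolic space: with `r = |u|`, the plane wave is a constant times `(1 - w t) ^ (-s)`, where `w =
2r / (1 + r²)` and `s = (d-1)/2 - iλ`. The binomial series and the moments of `t ^ n` give a Gauss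
function of `w²`. A quadratic transformation (`gauss_quadratic`) changes the argument to `r²`, and
Pfaff's and Euler's transformations (`olverF_eq_gauss`) change it to `-r² / (1 - r²)`, the argument
in the Legendre function. The transformations are proved by rearranging double series, summing the
coefficients by Chu–Vandermonde (`chu_vandermonde`), and continuing along `(0, 1)` where needed. -/

/-- The complex-valued function on `ℝ^d` given by a complex polynomial. -/
def polyFun {d : ℕ} (p : MvPolynomial (Fin d) ℂ) (y : EuclideanSpace ℝ (Fin d)) : ℂ :=
  MvPolynomial.eval (fun i => ((y i : ℝ) : ℂ)) p

/-- The (unnormalised) Gaussian weight on `ℝ^d`. -/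
def gaussWeight {d : ℕ} (y : EuclideanSpace ℝ (Fin d)) : ℂ :=
  ((Real.exp (-(1 / 2) * ‖y‖ ^ 2) : ℝ) : ℂ)

/-- The Gaussian integral of a polynomial. -/
def gaussInt {d : ℕ} (p : MvPolynomial (Fin d) ℂ) : ℂ :=
  ∫ y, polyFun p y * gaussWeight y

/-! ### Gaussian integrals of polynomials and integration by parts -/

/-- Links the formal `pderiv` to the Fréchet derivative, so that analytic integration by parts
becomes an algebraic rule on polynomials. -/
lemma hasFDerivAt_polyFun {d : ℕ} (p : MvPolynomial (Fin d) ℂ) (y : EuclideanSpace ℝ (Fin d)) :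
    HasFDerivAt (polyFun p)
      (∑ i, (polyFun (MvPolynomial.pderiv i p) y) •
        (Complex.ofRealCLM.comp (EuclideanSpace.proj i : EuclideanSpace ℝ (Fin d) →L[ℝ] ℝ))) y := by
  induction p using MvPolynomial.induction_on with
  | C a =>
    have : polyFun (MvPolynomial.C a : MvPolynomial (Fin d) ℂ) = fun _ => a := by
      funext y; simp [polyFun]
    rw [this]
    convert! hasFDerivAt_const (𝕜 := ℝ) a y using 1
    ext v
    simp only [polyFun, MvPolynomial.pderiv_C, map_zero, _root_.sum_apply, _root_.smul_apply,
      zero_smul, Finset.sum_const_zero, _root_.zero_apply]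
  | add p q hp hq =>
    have : polyFun (p + q) = polyFun p + polyFun q := by
      funext y; simp [polyFun]
    rw [this]
    convert! hp.add hq using 1
    ext v
    simp only [polyFun, map_add, _root_.sum_apply, _root_.smul_apply, _root_.add_apply,
      smul_eq_mul, add_mul, Finset.sum_add_distrib]
  | mul_X p j hp =>
    have : polyFun (p * MvPolynomial.X j) = fun y => polyFun p y * ((y j : ℝ) : ℂ) := by
      funext y; simp [polyFun]
    rw [this]
    have hj : HasFDerivAt (fun y : EuclideanSpace ℝ (Fin d) => ((y j : ℝ) : ℂ))
      (Complex.ofRealCLM.comp (EuclideanSpace.proj j : EuclideanSpace ℝ (Fin d) →L[ℝ] ℝ)) y :=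
      (Complex.ofRealCLM.comp
        (EuclideanSpace.proj j : EuclideanSpace ℝ (Fin d) →L[ℝ] ℝ)).hasFDerivAt
    convert! hp.mul hj using 1
    ext v
    classical
    simp only [polyFun, MvPolynomial.pderiv_mul, MvPolynomial.pderiv_X, map_add, map_mul,
      MvPolynomial.eval_X, _root_.sum_apply, _root_.add_apply,
      _root_.smul_apply, smul_eq_mul, add_mul, Finset.sum_add_distrib,
      Finset.mul_sum, ContinuousLinearMap.comp_apply]
    rw [add_comm]
    congr 1
    · rw [Finset.sum_eq_single j]
      · simp
      · intro b _ hb; simp [Pi.single_apply, hb.symm]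
      · simp
    · refine Finset.sum_congr rfl fun i _ => ?_
      ring

lemma differentiable_polyFun {d : ℕ} (p : MvPolynomial (Fin d) ℂ) :
    Differentiable ℝ (polyFun p) := fun y => (hasFDerivAt_polyFun p y).differentiableAt

lemma fderiv_polyFun {d : ℕ} (p : MvPolynomial (Fin d) ℂ) (y : EuclideanSpace ℝ (Fin d))
    (i : Fin d) :
    fderiv ℝ (polyFun p) y (EuclideanSpace.single i 1) = polyFun (MvPolynomial.pderiv i p) y := by
  rw [(hasFDerivAt_polyFun p y).fderiv, _root_.sum_apply, Finset.sum_eq_single i]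
  · simp
  · intro b _ hb; simp [hb]
  · simp

lemma hasFDerivAt_gaussWeight {d : ℕ} (y : EuclideanSpace ℝ (Fin d)) :
    HasFDerivAt (gaussWeight (d := d))
      (Complex.ofRealCLM.comp (-(Real.exp (-(1 / 2) * ‖y‖ ^ 2)) • innerSL ℝ y)) y := by
  have h : HasFDerivAt (fun y : EuclideanSpace ℝ (Fin d) => Real.exp (-(1 / 2) * ‖y‖ ^ 2))
      (-(Real.exp (-(1 / 2) * ‖y‖ ^ 2)) • innerSL ℝ y) y := by
    convert! (((hasStrictFDerivAt_norm_sq y).hasFDerivAt).const_mul (-(1 / 2) : ℝ)).exp using 1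
    ext v
    simp
  exact Complex.ofRealCLM.hasFDerivAt.comp y h

lemma differentiable_gaussWeight {d : ℕ} : Differentiable ℝ (gaussWeight (d := d)) :=
  fun y => (hasFDerivAt_gaussWeight y).differentiableAt

lemma fderiv_gaussWeight {d : ℕ} (y : EuclideanSpace ℝ (Fin d)) (i : Fin d) :
    fderiv ℝ (gaussWeight (d := d)) y (EuclideanSpace.single i 1) =
      -(((y i : ℝ) : ℂ) * gaussWeight y) := by
  rw [(hasFDerivAt_gaussWeight y).fderiv]
  simp [gaussWeight, mul_comm, EuclideanSpace.inner_single_right]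

lemma integrable_polyFun_mul_gaussWeight {d : ℕ} (hd : 1 ≤ d) (p : MvPolynomial (Fin d) ℂ) :
    Integrable (fun y => polyFun p y * gaussWeight y) := by
  have : Nonempty (Fin d) := ⟨⟨0, hd⟩⟩
  have hmeas : ∀ p : MvPolynomial (Fin d) ℂ,
      AEStronglyMeasurable (fun y => polyFun p y * gaussWeight y) volume := fun p =>
    ((differentiable_polyFun p).continuous.mul
      differentiable_gaussWeight.continuous).aestronglyMeasurable
  induction p using MvPolynomial.induction_on' with
  | monomial s a =>
    set N := ∑ i, s i with hN
    -- A monomial of degree `N` is at most `‖a‖ ‖y‖ ^ N`, so a radial majorant suffices; in polar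
    -- coordinates it is a one-dimensional Gaussian moment of order `d - 1 + N`.
    have hr : Integrable (fun y : EuclideanSpace ℝ (Fin d) =>
        (fun r : ℝ => ‖a‖ * (r ^ N * Real.exp (-(1 / 2) * r ^ 2))) ‖y‖) := by
      refine (integrable_fun_norm_addHaar volume
        (f := fun r : ℝ => ‖a‖ * (r ^ N * Real.exp (-(1 / 2) * r ^ 2)))).2 ?_
      have h := ((integrable_rpow_mul_exp_neg_mul_sq (b := 1 / 2) (by norm_num)
        (s := ((d - 1 + N : ℕ) : ℝ)) (by
          have : (0 : ℝ) ≤ ((d - 1 + N : ℕ) : ℝ) := by positivity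
          linarith)).const_mul ‖a‖).integrableOn (s := Set.Ioi 0)
      refine h.congr_fun (fun r _ => ?_) measurableSet_Ioi
      simp only [smul_eq_mul, Real.rpow_natCast, finrank_euclideanSpace, Fintype.card_fin]
      ring
    refine hr.mono' (hmeas _) (Eventually.of_forall fun y => ?_)
    rw [norm_mul]
    have h1 : ‖polyFun (MvPolynomial.monomial s a) y‖ ≤ ‖a‖ * ‖y‖ ^ N := by
      simp only [polyFun, MvPolynomial.eval_monomial, norm_mul]
      gcongr
      rw [Finsupp.prod_fintype _ _ (by simp), norm_prod, hN, ← Finset.prod_pow_eq_pow_sum]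
      refine Finset.prod_le_prod (fun _ _ => norm_nonneg _) fun i _ => ?_
      rw [norm_pow, Complex.norm_real]
      gcongr
      exact PiLp.norm_apply_le y i
    have h2 : ‖gaussWeight y‖ = Real.exp (-(1 / 2) * ‖y‖ ^ 2) := by
      rw [gaussWeight, Complex.norm_real, Real.norm_of_nonneg (Real.exp_pos _).le]
    rw [h2]
    calc _ ≤ ‖a‖ * ‖y‖ ^ N * Real.exp (-(1 / 2) * ‖y‖ ^ 2) := by gcongr
      _ = _ := by ring
  | add p q hp hq =>
    refine (hp.add hq).congr (Eventually.of_forall fun y => ?_)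
    simp [polyFun, add_mul]

lemma gaussInt_add {d : ℕ} (hd : 1 ≤ d) (p q : MvPolynomial (Fin d) ℂ) :
    gaussInt (p + q) = gaussInt p + gaussInt q := by
  rw [gaussInt, gaussInt, gaussInt, ← integral_add (integrable_polyFun_mul_gaussWeight hd p)
    (integrable_polyFun_mul_gaussWeight hd q)]
  simp [polyFun, add_mul]

lemma gaussInt_C_mul {d : ℕ} (a : ℂ) (p : MvPolynomial (Fin d) ℂ) :
    gaussInt (MvPolynomial.C a * p) = a * gaussInt p := by
  rw [gaussInt, gaussInt, ← integral_const_mul]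
  simp [polyFun, mul_assoc]

@[simp] lemma gaussInt_zero {d : ℕ} : gaussInt (0 : MvPolynomial (Fin d) ℂ) = 0 := by
  simp [gaussInt, polyFun]

lemma gaussInt_sum {d : ℕ} (hd : 1 ≤ d) {ι : Type*} (s : Finset ι)
    (f : ι → MvPolynomial (Fin d) ℂ) :
    gaussInt (∑ i ∈ s, f i) = ∑ i ∈ s, gaussInt (f i) := by
  classical
  induction s using Finset.induction_on with
  | empty => simp
  | insert a s ha ih => rw [Finset.sum_insert ha, Finset.sum_insert ha, gaussInt_add hd, ih]

/-- Gaussian integration by parts. -/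
lemma gaussInt_X_mul {d : ℕ} (hd : 1 ≤ d) (i : Fin d) (p : MvPolynomial (Fin d) ℂ) :
    gaussInt (MvPolynomial.X i * p) = gaussInt (MvPolynomial.pderiv i p) := by
  -- The weight satisfies `∂ᵢ w = -yᵢ w`, so moving the derivative off the weight trades the factor
  -- `yᵢ` for `∂ᵢ p`.
  have key := integral_mul_fderiv_eq_neg_fderiv_mul_of_integrable
    (μ := (volume : Measure (EuclideanSpace ℝ (Fin d))))
    (f := polyFun p) (g := gaussWeight) (v := EuclideanSpace.single i 1)
    (by simpa only [fderiv_polyFun] using integrable_polyFun_mul_gaussWeight hd _)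
    (by
      refine (integrable_polyFun_mul_gaussWeight hd (MvPolynomial.X i * p)).neg.congr
        (Eventually.of_forall fun y => ?_)
      simp only [fderiv_gaussWeight, polyFun, map_mul, MvPolynomial.eval_X, Pi.neg_apply]
      ring)
    (integrable_polyFun_mul_gaussWeight hd p)
    (fun x _ => differentiable_polyFun p x) (fun x _ => differentiable_gaussWeight x)
  simp only [fderiv_polyFun, fderiv_gaussWeight, mul_neg, integral_neg, neg_inj] at key
  rw [gaussInt, gaussInt, ← key]
  refine integral_congr_ae (Eventually.of_forall fun y => ?_)
  simp only [polyFun, map_mul, MvPolynomial.eval_X]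
  ring

lemma gaussInt_C {d : ℕ} (a : ℂ) :
    gaussInt (MvPolynomial.C a : MvPolynomial (Fin d) ℂ) =
      a * (((2 * Real.pi) ^ ((d : ℝ) / 2) : ℝ) : ℂ) := by
  have h := GaussianFourier.integral_rexp_neg_mul_sq_norm (V := EuclideanSpace ℝ (Fin d))
    (b := 1 / 2) (by norm_num)
  rw [finrank_euclideanSpace, Fintype.card_fin, show Real.pi / (1 / 2) = 2 * Real.pi by ring] at h
  rw [← h, ← integral_complex_ofReal, ← integral_const_mul, gaussInt]
  simp [polyFun, gaussWeight]

/-! ### Gaussian moments of harmonic forms along a direction -/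

/-- The linear form `y ↦ x · y`. -/
def linForm {d : ℕ} (x : EuclideanSpace ℝ (Fin d)) : MvPolynomial (Fin d) ℂ :=
  ∑ i, MvPolynomial.C ((x i : ℝ) : ℂ) * MvPolynomial.X i

/-- The directional derivative of a polynomial. -/
def dirDeriv {d : ℕ} (x : EuclideanSpace ℝ (Fin d)) (p : MvPolynomial (Fin d) ℂ) :
    MvPolynomial (Fin d) ℂ :=
  ∑ i, MvPolynomial.C ((x i : ℝ) : ℂ) * MvPolynomial.pderiv i p

lemma pderiv_linForm {d : ℕ} (x : EuclideanSpace ℝ (Fin d)) (i : Fin d) :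
    MvPolynomial.pderiv i (linForm x) = MvPolynomial.C ((x i : ℝ) : ℂ) := by
  classical
  simp only [linForm, map_sum, MvPolynomial.pderiv_C_mul, MvPolynomial.pderiv_X]
  rw [Finset.sum_eq_single i]
  · simp
  · intro b _ hb; simp [Pi.single_apply, hb]
  · simp

lemma polyFun_linForm {d : ℕ} (x y : EuclideanSpace ℝ (Fin d)) :
    polyFun (linForm x) y = ((inner ℝ x y : ℝ) : ℂ) := by
  simp [polyFun, linForm, PiLp.inner_apply, mul_comm]

/-- The Laplacian of a polynomial. -/
def polyLaplacian {d : ℕ} (p : MvPolynomial (Fin d) ℂ) : MvPolynomial (Fin d) ℂ :=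
  ∑ i, MvPolynomial.pderiv i (MvPolynomial.pderiv i p)

/-- The commutator of two derivations is a derivation, and this one kills every variable. -/
lemma pderiv_pderiv_comm {d : ℕ} (i j : Fin d) (p : MvPolynomial (Fin d) ℂ) :
    MvPolynomial.pderiv i (MvPolynomial.pderiv j p) =
      MvPolynomial.pderiv j (MvPolynomial.pderiv i p) := by
  have : ⁅(MvPolynomial.pderiv i : Derivation ℂ (MvPolynomial (Fin d) ℂ) _),
      (MvPolynomial.pderiv j : Derivation ℂ (MvPolynomial (Fin d) ℂ) _)⁆ = 0 := by
    classical
    refine MvPolynomial.derivation_ext fun k => ?_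
    rw [Derivation.commutator_apply]
    simp [MvPolynomial.pderiv_X, Pi.single_apply, apply_ite]
  have h := congrArg (fun D => D p) this
  simpa [Derivation.commutator_apply, sub_eq_zero] using h

lemma polyLaplacian_dirDeriv {d : ℕ} (x : EuclideanSpace ℝ (Fin d))
    (p : MvPolynomial (Fin d) ℂ) :
    polyLaplacian (dirDeriv x p) = dirDeriv x (polyLaplacian p) := by
  simp only [polyLaplacian, dirDeriv, map_sum, MvPolynomial.pderiv_C_mul, Finset.mul_sum]
  rw [Finset.sum_comm]
  refine Finset.sum_congr rfl fun i _ => Finset.sum_congr rfl fun j _ => ?_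
  rw [pderiv_pderiv_comm j i p, pderiv_pderiv_comm j i]

lemma isHomogeneous_dirDeriv {d ℓ : ℕ} (x : EuclideanSpace ℝ (Fin d))
    {p : MvPolynomial (Fin d) ℂ} (hp : p.IsHomogeneous ℓ) :
    (dirDeriv x p).IsHomogeneous (ℓ - 1) := by
  refine MvPolynomial.IsHomogeneous.sum _ _ _ fun i _ => ?_
  simpa using (MvPolynomial.isHomogeneous_C (Fin d) ((x i : ℝ) : ℂ)).mul (hp.pderiv (i := i))

lemma polyFun_dirDeriv_self {d ℓ : ℕ} (x : EuclideanSpace ℝ (Fin d))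
    {p : MvPolynomial (Fin d) ℂ} (hp : p.IsHomogeneous ℓ) :
    polyFun (dirDeriv x p) x = ℓ * polyFun p x := by
  have h := congrArg (fun q => polyFun q x) hp.sum_X_mul_pderiv
  simpa [polyFun, dirDeriv] using h

/-- Gaussian moments of a polynomial against powers of a linear form: recursion. -/
lemma gaussInt_linForm_pow_succ_mul {d : ℕ} (hd : 1 ≤ d) (x : EuclideanSpace ℝ (Fin d))
    (hx : ‖x‖ = 1) (n : ℕ) (p : MvPolynomial (Fin d) ℂ) :
    gaussInt (linForm x ^ (n + 1) * p) =
      n * gaussInt (linForm x ^ (n - 1) * p) + gaussInt (linForm x ^ n * dirDeriv x p) := by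
  have h1 : linForm x ^ (n + 1) * p =
      ∑ i, MvPolynomial.C ((x i : ℝ) : ℂ) * (MvPolynomial.X i * (linForm x ^ n * p)) := by
    rw [pow_succ', mul_assoc]
    nth_rw 1 [linForm]
    rw [Finset.sum_mul]
    refine Finset.sum_congr rfl fun i _ => by ring
  -- Since `∂ᵢ` of the linear form is `xᵢ`, the terms differentiating the power carry the total
  -- weight `∑ xᵢ² = 1`.
  have hx2 : ∑ i, ((x i : ℝ) : ℂ) * ((x i : ℝ) : ℂ) = 1 := by
    have := EuclideanSpace.real_norm_sq_eq x
    rw [hx] at this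
    have h := congrArg (fun r : ℝ => (r : ℂ)) this
    push_cast at h
    rw [← Finset.sum_congr rfl fun i _ => sq _, ← h]
    norm_num
  have h2 : ∀ i, gaussInt (MvPolynomial.C ((x i : ℝ) : ℂ) *
      (MvPolynomial.X i * (linForm x ^ n * p))) =
      ((x i : ℝ) : ℂ) * ((x i : ℝ) : ℂ) * (n * gaussInt (linForm x ^ (n - 1) * p)) +
      gaussInt (linForm x ^ n * (MvPolynomial.C ((x i : ℝ) : ℂ) * MvPolynomial.pderiv i p)) := by
    intro i
    rw [gaussInt_C_mul, gaussInt_X_mul hd, MvPolynomial.pderiv_mul, MvPolynomial.pderiv_pow,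
      pderiv_linForm, gaussInt_add hd,
      show (n : MvPolynomial (Fin d) ℂ) * linForm x ^ (n - 1) * MvPolynomial.C ((x i : ℝ) : ℂ) * p
        = MvPolynomial.C ((n : ℂ) * ((x i : ℝ) : ℂ)) * (linForm x ^ (n - 1) * p) by
        rw [MvPolynomial.C_mul, map_natCast]; ring,
      show linForm x ^ n * (MvPolynomial.C ((x i : ℝ) : ℂ) * MvPolynomial.pderiv i p) =
        MvPolynomial.C ((x i : ℝ) : ℂ) * (linForm x ^ n * MvPolynomial.pderiv i p) by ring,
      gaussInt_C_mul, gaussInt_C_mul]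
    ring
  rw [h1, gaussInt_sum hd, Finset.sum_congr rfl fun i _ => h2 i, Finset.sum_add_distrib,
    ← Finset.sum_mul, hx2, one_mul, ← gaussInt_sum hd, ← Finset.mul_sum, dirDeriv]

/-- The Gaussian mean of a harmonic form of positive degree vanishes. -/
lemma gaussInt_eq_zero_of_harmonic {d ℓ : ℕ} (hd : 1 ≤ d) (hℓ : ℓ ≠ 0)
    {p : MvPolynomial (Fin d) ℂ} (hp : p.IsHomogeneous ℓ) (hh : polyLaplacian p = 0) :
    gaussInt p = 0 := by
  -- By Euler, `ℓ p = ∑ Xᵢ ∂ᵢ p`; integrating each term by parts gives the Gaussian integral of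
  -- `Δp`, which is `0`.
  have h := congrArg gaussInt hp.sum_X_mul_pderiv
  rw [gaussInt_sum hd, Finset.sum_congr rfl fun i _ => gaussInt_X_mul hd i _, ← gaussInt_sum hd]
    at h
  rw [polyLaplacian] at hh
  rw [hh, gaussInt_zero, nsmul_eq_mul, ← map_natCast MvPolynomial.C, gaussInt_C_mul] at h
  have : (ℓ : ℂ) ≠ 0 := by exact_mod_cast hℓ
  simpa [this] using h.symm

lemma dirDeriv_eq_zero_of_isHomogeneous_zero {d : ℕ} (x : EuclideanSpace ℝ (Fin d))
    {p : MvPolynomial (Fin d) ℂ} (hp : p.IsHomogeneous 0) : dirDeriv x p = 0 := by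
  rw [← MvPolynomial.totalDegree_zero_iff_isHomogeneous, MvPolynomial.totalDegree_eq_zero_iff_eq_C]
    at hp
  rw [hp]
  simp [dirDeriv]

/-- Gaussian moments of a harmonic form against powers of a linear form. -/
lemma gaussInt_linForm_pow_mul {d : ℕ} (hd : 1 ≤ d) (x : EuclideanSpace ℝ (Fin d))
    (hx : ‖x‖ = 1) (n : ℕ) : ∀ (ℓ : ℕ) (p : MvPolynomial (Fin d) ℂ), p.IsHomogeneous ℓ →
    polyLaplacian p = 0 →
    (∀ k, n = ℓ + 2 * k → gaussInt (linForm x ^ n * p) =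
      (((2 * Real.pi) ^ ((d : ℝ) / 2) : ℝ) : ℂ) * (n.factorial / (2 ^ k * k.factorial)) *
        polyFun p x) ∧
    ((∀ k, n ≠ ℓ + 2 * k) → gaussInt (linForm x ^ n * p) = 0) := by
  -- The degree `ℓ` and the form `p` stay universally quantified because the recursion replaces `p`
  -- by its directional derivative, of degree `ℓ - 1`.
  induction n using Nat.strong_induction_on with
  | _ n ih =>
  intro ℓ p hp hh
  have hD : polyLaplacian (dirDeriv x p) = 0 := by
    rw [polyLaplacian_dirDeriv, hh]; simp [dirDeriv]
  obtain rfl | ⟨m, rfl⟩ : n = 0 ∨ ∃ m, n = m + 1 := by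
    cases n with
    | zero => exact Or.inl rfl
    | succ m => exact Or.inr ⟨m, rfl⟩
  · refine ⟨fun k hk => ?_, fun hk => ?_⟩
    · obtain ⟨rfl, rfl⟩ : ℓ = 0 ∧ k = 0 := by omega
      have h0 := hp
      rw [← MvPolynomial.totalDegree_zero_iff_isHomogeneous,
        MvPolynomial.totalDegree_eq_zero_iff_eq_C] at h0
      rw [h0]
      simp [gaussInt_C, polyFun, mul_comm]
    · rw [pow_zero, one_mul]
      exact gaussInt_eq_zero_of_harmonic hd (fun h => hk 0 (by omega)) hp hh
  · rw [gaussInt_linForm_pow_succ_mul hd x hx]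
    have ihD := ih m (by omega) (ℓ - 1) _ (isHomogeneous_dirDeriv x hp) hD
    -- For `ℓ = 0` the truncated degree `ℓ - 1` is again `0` and the induction hypothesis has the
    -- wrong parity; the directional derivative is simply zero.
    have hz : ℓ = 0 → gaussInt (linForm x ^ m * dirDeriv x p) = 0 := by
      rintro rfl
      simp [dirDeriv_eq_zero_of_isHomogeneous_zero x hp]
    refine ⟨fun k hk => ?_, fun hk => ?_⟩
    · have e1 : gaussInt (linForm x ^ m * dirDeriv x p) =
          (((2 * Real.pi) ^ ((d : ℝ) / 2) : ℝ) : ℂ) * (m.factorial / (2 ^ k * k.factorial)) *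
            (ℓ * polyFun p x) := by
        rcases Nat.eq_zero_or_pos ℓ with h | h
        · rw [hz h]; simp [h]
        · rw [ihD.1 k (by omega), polyFun_dirDeriv_self x hp]
      have e2 : (m : ℂ) * gaussInt (linForm x ^ (m - 1) * p) =
          (((2 * Real.pi) ^ ((d : ℝ) / 2) : ℝ) : ℂ) * (m.factorial / (2 ^ k * k.factorial)) *
            (2 * k * polyFun p x) := by
        rcases Nat.eq_zero_or_pos m with h | h
        · subst h
          obtain rfl : k = 0 := by omega
          simp
        · have ihp := ih (m - 1) (by omega) ℓ p hp hh
          obtain ⟨m, rfl⟩ : ∃ j, m = j + 1 := ⟨m - 1, by omega⟩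
          rcases Nat.eq_zero_or_pos k with hk0 | hk0
          · rw [ihp.2 (fun j => by omega)]; simp [hk0]
          · obtain ⟨k, rfl⟩ : ∃ j, k = j + 1 := ⟨k - 1, by omega⟩
            rw [ihp.1 k (by omega)]
            have : (k.factorial : ℂ) ≠ 0 := by exact_mod_cast k.factorial_ne_zero
            have h3 : (k : ℂ) + 1 ≠ 0 := by exact_mod_cast k.succ_ne_zero
            simp only [Nat.add_sub_cancel, Nat.factorial_succ, pow_succ]
            push_cast
            field_simp
      -- The two contributions are `ℓ` and `2k` times a common factor, and `ℓ + 2k = m + 1` turns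
      -- `m!` into `(m + 1)!`.
      rw [e1, e2, Nat.factorial_succ]
      have : ((m + 1 : ℕ) : ℂ) = ℓ + 2 * k := by rw [hk]; push_cast; ring
      rw [Nat.cast_mul, this]
      ring
    · have e1 : gaussInt (linForm x ^ m * dirDeriv x p) = 0 := by
        rcases Nat.eq_zero_or_pos ℓ with h | h
        · exact hz h
        · exact ihD.2 fun k hk' => hk k (by omega)
      have e2 : (m : ℂ) * gaussInt (linForm x ^ (m - 1) * p) = 0 := by
        rcases Nat.eq_zero_or_pos m with h | h
        · simp [h]
        · rw [(ih (m - 1) (by omega) ℓ p hp hh).2 fun k hk' => hk (k + 1) (by omega), mul_zero]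
      rw [e1, e2, add_zero]

/-! ### Polar coordinates and moments on the sphere -/

lemma polyFun_smul {d m : ℕ} {p : MvPolynomial (Fin d) ℂ} (hp : p.IsHomogeneous m) (r : ℝ)
    (y : EuclideanSpace ℝ (Fin d)) : polyFun p (r • y) = (r : ℂ) ^ m * polyFun p y := by
  rw [polyFun, polyFun, MvPolynomial.eval_eq, MvPolynomial.eval_eq, Finset.mul_sum]
  refine Finset.sum_congr rfl fun s hs => ?_
  have hs' : ∑ i ∈ s.support, s i = m := by
    have := hp (MvPolynomial.mem_support_iff.1 hs)
    rwa [Finsupp.weight_apply, Finsupp.sum, Finset.sum_congr rfl fun i _ => by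
      rw [Pi.one_apply, smul_eq_mul, mul_one]] at this
  simp only [PiLp.smul_apply, smul_eq_mul, Complex.ofReal_mul, mul_pow, Finset.prod_mul_distrib]
  rw [Finset.prod_pow_eq_pow_sum, hs']
  ring

lemma integral_volumeIoiPow_gaussian {d : ℕ} (hd : 1 ≤ d) (m : ℕ) :
    ∫ r : Set.Ioi (0 : ℝ), ((r.1 ^ m * Real.exp (-(1 / 2) * r.1 ^ 2) : ℝ) : ℂ)
      ∂(Measure.volumeIoiPow (d - 1)) =
      (((2 : ℝ) ^ (((d : ℝ) + m) / 2 - 1) * Real.Gamma (((d : ℝ) + m) / 2) : ℝ) : ℂ) := by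
  rw [integral_complex_ofReal]
  congr 1
  simp only [Measure.volumeIoiPow, ENNReal.ofReal]
  rw [integral_withDensity_eq_integral_smul
      (measurable_subtype_coe.pow_const _).real_toNNReal,
    integral_subtype_comap measurableSet_Ioi fun a : ℝ =>
      Real.toNNReal (a ^ (d - 1)) • (a ^ m * Real.exp (-(1 / 2) * a ^ 2)),
    setIntegral_congr_fun (g := fun r : ℝ =>
      r ^ ((d : ℝ) - 1 + m) * Real.exp (-(1 / 2) * r ^ (2 : ℝ))) measurableSet_Ioi fun x hx => ?_]
  · have hd' : (1 : ℝ) ≤ d := by exact_mod_cast hd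
    rw [integral_rpow_mul_exp_neg_mul_rpow (by norm_num)
      (by have : (0 : ℝ) ≤ m := by positivity
          linarith) (by norm_num)]
    rw [show (d : ℝ) - 1 + m + 1 = d + m by ring]
    rw [show (1 / 2 : ℝ) = 2⁻¹ by norm_num, Real.inv_rpow (by norm_num), ← Real.rpow_neg
      (by norm_num), show -(-((d : ℝ) + m) / 2) = (d + m) / 2 by ring, Real.rpow_sub_one (by norm_num)]
    ring
  · have hx0 : (0 : ℝ) < x := hx
    simp only [NNReal.smul_def, Real.coe_toNNReal _ (pow_nonneg hx0.le _), smul_eq_mul]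
    rw [← mul_assoc, ← pow_add]
    congr 1
    · rw [← Real.rpow_natCast]
      congr 1
      push_cast [Nat.cast_sub hd]
      ring
    · norm_cast

/-- Gaussian integrals of homogeneous polynomials in polar coordinates. -/
lemma gaussInt_eq_integral_sphere {d m : ℕ} (hd : 1 ≤ d) {p : MvPolynomial (Fin d) ℂ}
    (hp : p.IsHomogeneous m) :
    gaussInt p = (((2 : ℝ) ^ (((d : ℝ) + m) / 2 - 1) * Real.Gamma (((d : ℝ) + m) / 2) : ℝ) : ℂ) *
      ∫ θ : USphere d, polyFun p θ.1 ∂(surfaceMeasure d) := by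
  have : Nonempty (Fin d) := ⟨⟨0, hd⟩⟩
  have hmp := (volume : Measure (EuclideanSpace ℝ (Fin d))).measurePreserving_homeomorphUnitSphereProd
  rw [finrank_euclideanSpace, Fintype.card_fin] at hmp
  rw [← integral_volumeIoiPow_gaussian hd, mul_comm, surfaceMeasure,
    ← integral_prod_mul (fun θ : USphere d => polyFun p θ.1) (fun r : Set.Ioi (0 : ℝ) =>
      ((r.1 ^ m * Real.exp (-(1 / 2) * r.1 ^ 2) : ℝ) : ℂ)), gaussInt]
  have hcomp := hmp.integral_comp (Homeomorph.measurableEmbedding _)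
    (fun z : USphere d × Set.Ioi (0 : ℝ) => polyFun p z.1.1 *
      ((z.2.1 ^ m * Real.exp (-(1 / 2) * z.2.1 ^ 2) : ℝ) : ℂ))
  rw [← hcomp]
  -- Polar coordinates live on the complement of the origin, which is a null set.
  have hsub := integral_subtype_comap (μ := volume)
    (measurableSet_singleton (0 : EuclideanSpace ℝ (Fin d))).compl
    fun y : EuclideanSpace ℝ (Fin d) => polyFun p y * gaussWeight y
  rw [restrict_compl_singleton] at hsub
  rw [← hsub]
  refine integral_congr_ae (Eventually.of_forall fun y => ?_)
  have hy : y.1 = ‖y.1‖ • (‖y.1‖⁻¹ • y.1) := by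
    rw [smul_smul, mul_inv_cancel₀ (norm_ne_zero_iff.2 y.2), one_smul]
  simp only [homeomorphUnitSphereProd_apply_fst_coe, homeomorphUnitSphereProd_apply_snd_coe]
  nth_rw 1 [hy]
  rw [polyFun_smul hp, gaussWeight]
  push_cast
  ring

lemma isHomogeneous_linForm {d : ℕ} (x : EuclideanSpace ℝ (Fin d)) :
    (linForm x).IsHomogeneous 1 := by
  refine MvPolynomial.IsHomogeneous.sum _ _ _ fun i _ => ?_
  simpa using (MvPolynomial.isHomogeneous_C (Fin d) ((x i : ℝ) : ℂ)).mul
    (MvPolynomial.isHomogeneous_X ℂ i)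

/-- Gaussian moments of a homogeneous polynomial along the direction `ω`, in polar coordinates. -/
lemma gaussInt_linForm_pow_mul_eq_integral_sphere {d ℓ : ℕ} (hd : 1 ≤ d) {p : MvPolynomial (Fin d) ℂ}
    (hp : p.IsHomogeneous ℓ) {Y : C(USphere d, ℂ)} (hY : ∀ θ : USphere d, Y θ = polyFun p θ.1)
    (ω : USphere d) (n : ℕ) :
    gaussInt (linForm ω.1 ^ n * p) =
      (((2 : ℝ) ^ (((d : ℝ) + (n + ℓ : ℕ)) / 2 - 1) *
        Real.Gamma (((d : ℝ) + (n + ℓ : ℕ)) / 2) : ℝ) : ℂ) *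
      ∫ θ : USphere d, ((inner ℝ ω.1 θ.1 : ℝ) : ℂ) ^ n * Y θ ∂(surfaceMeasure d) := by
  have hh : (linForm ω.1 ^ n * p).IsHomogeneous (n + ℓ) := by
    simpa using ((isHomogeneous_linForm ω.1).pow n).mul hp
  rw [gaussInt_eq_integral_sphere hd hh]
  congr 1
  refine integral_congr_ae (Eventually.of_forall fun θ => ?_)
  simp only [hY, ← polyFun_linForm]
  simp [polyFun]

/-- Moments of a spherical harmonic. -/
lemma IsSphericalHarmonic.integral_inner_pow {d ℓ : ℕ} (hd : 1 ≤ d) {Y : C(USphere d, ℂ)}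
    (hY : IsSphericalHarmonic d ℓ Y) (ω : USphere d) (k : ℕ) :
    ∫ θ : USphere d, ((inner ℝ ω.1 θ.1 : ℝ) : ℂ) ^ (ℓ + 2 * k) * Y θ ∂(surfaceMeasure d) =
      (((2 * Real.pi ^ ((d : ℝ) / 2)) * (ℓ + 2 * k).factorial /
        (2 ^ (ℓ + 2 * k) * k.factorial * Real.Gamma ((d : ℝ) / 2 + ℓ + k)) : ℝ) : ℂ) * Y ω := by
  obtain ⟨p, hp, hh, hYp⟩ := hY
  have hω : ‖ω.1‖ = 1 := by simp
  have h1 := gaussInt_linForm_pow_mul_eq_integral_sphere hd hp hYp ω (ℓ + 2 * k)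
  rw [(gaussInt_linForm_pow_mul hd ω.1 hω (ℓ + 2 * k) ℓ p hp hh).1 k rfl] at h1
  have hd0 : (1 : ℝ) ≤ d := by exact_mod_cast hd
  have hG : 0 < Real.Gamma ((d : ℝ) / 2 + ℓ + k) := Real.Gamma_pos_of_pos (by positivity)
  have e : ((d : ℝ) + (ℓ + 2 * k + ℓ : ℕ)) / 2 = (d : ℝ) / 2 + ℓ + k := by push_cast; ring
  rw [e] at h1
  have e2 : (2 : ℝ) ^ ((d : ℝ) / 2 + ℓ + k - 1) = 2 ^ ((d : ℝ) / 2) * 2 ^ ℓ * 2 ^ k / 2 := by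
    rw [Real.rpow_sub_one (by norm_num), Real.rpow_add (by norm_num), Real.rpow_add (by norm_num),
      Real.rpow_natCast, Real.rpow_natCast]
  have hne : (((2 : ℝ) ^ ((d : ℝ) / 2 + ℓ + k - 1) * Real.Gamma ((d : ℝ) / 2 + ℓ + k) : ℝ) : ℂ) ≠ 0 := by
    exact_mod_cast (by positivity : (2 : ℝ) ^ ((d : ℝ) / 2 + ℓ + k - 1) *
      Real.Gamma ((d : ℝ) / 2 + ℓ + k) ≠ 0)
  refine mul_left_cancel₀ hne ?_
  rw [← h1, hYp ω, ← mul_assoc, ← Complex.ofReal_mul]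
  change _ = _ * polyFun p ω.1
  congr 1
  rw [e2, Real.mul_rpow (by norm_num) Real.pi_pos.le]
  have h3 : (2 : ℝ) ^ ((d : ℝ) / 2) ≠ 0 := by positivity
  have : ((ℓ + 2 * k).factorial : ℂ) / (2 ^ k * k.factorial) =
    (((ℓ + 2 * k).factorial / (2 ^ k * k.factorial) : ℝ) : ℂ) := by push_cast; rfl
  rw [this, ← Complex.ofReal_mul]
  congr 1
  have hk : (k.factorial : ℝ) ≠ 0 := by exact_mod_cast k.factorial_ne_zero
  rw [pow_add, pow_mul' (2 : ℝ) 2 k, sq]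
  field_simp

lemma IsSphericalHarmonic.integral_inner_pow_eq_zero {d ℓ : ℕ} (hd : 1 ≤ d) {Y : C(USphere d, ℂ)}
    (hY : IsSphericalHarmonic d ℓ Y) (ω : USphere d) {n : ℕ} (hn : ∀ k, n ≠ ℓ + 2 * k) :
    ∫ θ : USphere d, ((inner ℝ ω.1 θ.1 : ℝ) : ℂ) ^ n * Y θ ∂(surfaceMeasure d) = 0 := by
  obtain ⟨p, hp, hh, hYp⟩ := hY
  have hω : ‖ω.1‖ = 1 := by simp
  have h1 := gaussInt_linForm_pow_mul_eq_integral_sphere hd hp hYp ω n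
  rw [(gaussInt_linForm_pow_mul hd ω.1 hω n ℓ p hp hh).2 hn] at h1
  have hd0 : (1 : ℝ) ≤ d := by exact_mod_cast hd
  have hG : 0 < Real.Gamma (((d : ℝ) + (n + ℓ : ℕ)) / 2) := Real.Gamma_pos_of_pos (by positivity)
  have hne : (((2 : ℝ) ^ (((d : ℝ) + (n + ℓ : ℕ)) / 2 - 1) *
        Real.Gamma (((d : ℝ) + (n + ℓ : ℕ)) / 2) : ℝ) : ℂ) ≠ 0 := by
    exact_mod_cast (by positivity : (2 : ℝ) ^ (((d : ℝ) + (n + ℓ : ℕ)) / 2 - 1) *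
        Real.Gamma (((d : ℝ) + (n + ℓ : ℕ)) / 2) ≠ 0)
  exact (mul_eq_zero.1 h1.symm).resolve_left hne

lemma integrable_of_continuous_sphere {d : ℕ} {f : USphere d → ℂ} (hf : Continuous f) :
    Integrable f (surfaceMeasure d) :=
  hf.integrable_of_hasCompactSupport (HasCompactSupport.of_compactSpace _)

/-- The eigenvalue equation of `Y` expressed on monomials. The form without division covers
vanishing moments too, including `n + 2 = ℓ`, where the left factor is zero. -/
lemma IsSphericalHarmonic.integral_inner_pow_add_two {d ℓ : ℕ} (hd : 1 ≤ d) {Y : C(USphere d, ℂ)}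
    (hY : IsSphericalHarmonic d ℓ Y) (ω : USphere d) (n : ℕ) :
    ((n : ℂ) + 2 - ℓ) * (n + ℓ + d) *
      ∫ θ : USphere d, ((inner ℝ ω.1 θ.1 : ℝ) : ℂ) ^ (n + 2) * Y θ ∂(surfaceMeasure d) =
    ((n : ℂ) + 2) * (n + 1) *
      ∫ θ : USphere d, ((inner ℝ ω.1 θ.1 : ℝ) : ℂ) ^ n * Y θ ∂(surfaceMeasure d) := by
  by_cases h : ∃ k, n = ℓ + 2 * k
  · obtain ⟨k, rfl⟩ := h
    rw [hY.integral_inner_pow hd ω k, show ℓ + 2 * k + 2 = ℓ + 2 * (k + 1) by ring,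
      hY.integral_inner_pow hd ω (k + 1), ← mul_assoc, ← mul_assoc]
    congr 1
    have hd0 : (1 : ℝ) ≤ d := by exact_mod_cast hd
    have hpos : (0 : ℝ) < (d : ℝ) / 2 + ℓ + k := by positivity
    have hG : Real.Gamma ((d : ℝ) / 2 + ℓ + k) ≠ 0 := (Real.Gamma_pos_of_pos hpos).ne'
    have hk : (k.factorial : ℝ) ≠ 0 := by exact_mod_cast k.factorial_ne_zero
    have hk1 : (k : ℝ) + 1 ≠ 0 := by positivity
    have e : (((ℓ + 2 * k : ℕ) : ℝ) + 2 - ℓ) * ((ℓ + 2 * k : ℕ) + ℓ + d) *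
      (2 * Real.pi ^ ((d : ℝ) / 2) * ((ℓ + 2 * (k + 1)).factorial : ℝ) /
        (2 ^ (ℓ + 2 * (k + 1)) * ((k + 1).factorial : ℝ) *
          Real.Gamma ((d : ℝ) / 2 + ℓ + (k + 1 : ℕ)))) =
      (((ℓ + 2 * k : ℕ) : ℝ) + 2) * ((ℓ + 2 * k : ℕ) + 1) *
      (2 * Real.pi ^ ((d : ℝ) / 2) * ((ℓ + 2 * k).factorial : ℝ) /
        (2 ^ (ℓ + 2 * k) * (k.factorial : ℝ) * Real.Gamma ((d : ℝ) / 2 + ℓ + k))) := by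
      rw [show (d : ℝ) / 2 + ℓ + (k + 1 : ℕ) = (d : ℝ) / 2 + ℓ + k + 1 by push_cast; ring,
        Real.Gamma_add_one hpos.ne', show ℓ + 2 * (k + 1) = ℓ + 2 * k + 1 + 1 by ring,
        Nat.factorial_succ, Nat.factorial_succ (ℓ + 2 * k), Nat.factorial_succ k,
        pow_succ, pow_succ]
      push_cast
      field_simp
      ring
    exact_mod_cast e
  · push Not at h
    rw [hY.integral_inner_pow_eq_zero hd ω h, mul_zero]
    by_cases h2 : n + 2 = ℓ
    · have : (n : ℂ) + 2 - ℓ = 0 := by rw [← h2]; push_cast; ring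
      rw [this]; ring
    · rw [hY.integral_inner_pow_eq_zero hd ω (n := n + 2), mul_zero]
      intro k hk
      rcases Nat.eq_zero_or_pos k with hk0 | hk0
      · exact h2 (by omega)
      · exact h (k - 1) (by omega)

/-! ### Zonal polynomials and moments centred at the pole -/

/-- The pairing of a zonal polynomial with a function on the sphere. -/
def zonalPairing {d : ℕ} (Y : C(USphere d, ℂ)) (ω : USphere d) : Polynomial ℂ →ₗ[ℂ] ℂ where
  toFun q := ∫ θ : USphere d, q.eval ((inner ℝ ω.1 θ.1 : ℝ) : ℂ) * Y θ ∂(surfaceMeasure d)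
  map_add' p q := by
    rw [← integral_add]
    · simp [add_mul]
    · exact integrable_of_continuous_sphere (by fun_prop)
    · exact integrable_of_continuous_sphere (by fun_prop)
  map_smul' c p := by
    simp [mul_assoc, integral_const_mul]

lemma zonalPairing_apply {d : ℕ} (Y : C(USphere d, ℂ)) (ω : USphere d) (q : Polynomial ℂ) :
    zonalPairing Y ω q =
      ∫ θ : USphere d, q.eval ((inner ℝ ω.1 θ.1 : ℝ) : ℂ) * Y θ ∂(surfaceMeasure d) := rfl

lemma zonalPairing_C_mul {d : ℕ} (Y : C(USphere d, ℂ)) (ω : USphere d) (a : ℂ)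
    (q : Polynomial ℂ) : zonalPairing Y ω (Polynomial.C a * q) = a * zonalPairing Y ω q := by
  rw [← Polynomial.smul_eq_C_mul, map_smul, smul_eq_mul]

lemma zonalPairing_X_pow {d : ℕ} (Y : C(USphere d, ℂ)) (ω : USphere d) (n : ℕ) :
    zonalPairing Y ω (Polynomial.X ^ n) =
      ∫ θ : USphere d, ((inner ℝ ω.1 θ.1 : ℝ) : ℂ) ^ n * Y θ ∂(surfaceMeasure d) := by
  simp [zonalPairing_apply]

/-- The zonal part of the operator `Δ_{𝕊^{d-1}} + ℓ(ℓ+d-2)`. -/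
def gegenbauerOp (d ℓ : ℕ) (q : Polynomial ℂ) : Polynomial ℂ :=
  (1 - Polynomial.X ^ 2) * Polynomial.derivative (Polynomial.derivative q) -
    Polynomial.C ((d : ℂ) - 1) * Polynomial.X * Polynomial.derivative q +
    Polynomial.C ((ℓ : ℂ) * (ℓ + d - 2)) * q

/-- Zonal polynomials in the range of `Δ_{𝕊^{d-1}} + ℓ(ℓ+d-2)` are orthogonal to the spherical
harmonics of degree `ℓ`. -/
lemma IsSphericalHarmonic.zonalPairing_gegenbauerOp {d ℓ : ℕ} (hd : 1 ≤ d) {Y : C(USphere d, ℂ)}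
    (hY : IsSphericalHarmonic d ℓ Y) (ω : USphere d) (q : Polynomial ℂ) :
    zonalPairing Y ω (gegenbauerOp d ℓ q) = 0 := by
  induction q using Polynomial.induction_on' with
  | add p q hp hq =>
    have : gegenbauerOp d ℓ (p + q) = gegenbauerOp d ℓ p + gegenbauerOp d ℓ q := by
      simp only [gegenbauerOp, Polynomial.derivative_add]; ring
    rw [this, map_add, hp, hq, add_zero]
  | monomial n a =>
    rw [← Polynomial.C_mul_X_pow_eq_monomial]
    match n with
    | 0 =>
      have : gegenbauerOp d ℓ (Polynomial.C a * Polynomial.X ^ 0) =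
          Polynomial.C (a * (ℓ * (ℓ + d - 2))) * Polynomial.X ^ 0 := by
        simp [gegenbauerOp]; ring
      rw [this, zonalPairing_C_mul, zonalPairing_X_pow]
      rcases Nat.eq_zero_or_pos ℓ with h | h
      · simp [h]
      · rw [hY.integral_inner_pow_eq_zero hd ω (fun k => by omega), mul_zero]
    | 1 =>
      have : gegenbauerOp d ℓ (Polynomial.C a * Polynomial.X ^ 1) =
          Polynomial.C (a * ((ℓ - 1) * (ℓ + d - 1))) * Polynomial.X ^ 1 := by
        have e : a * (((ℓ : ℂ) - 1) * (ℓ + d - 1)) = a * (ℓ * (ℓ + d - 2)) - a * (d - 1) := by ring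
        rw [e]
        simp [gegenbauerOp]; ring
      rw [this, zonalPairing_C_mul, zonalPairing_X_pow]
      by_cases h : ℓ = 1
      · simp [h]
      · rw [hY.integral_inner_pow_eq_zero hd ω (fun k => by omega), mul_zero]
    | n + 2 =>
      have : gegenbauerOp d ℓ (Polynomial.C a * Polynomial.X ^ (n + 2)) =
          Polynomial.C a * (Polynomial.C (((n : ℂ) + 2) * (n + 1)) * Polynomial.X ^ n -
            Polynomial.C (((n : ℂ) + 2 - ℓ) * (n + ℓ + d)) * Polynomial.X ^ (n + 2)) := by
        have e : ((n : ℂ) + 2 - ℓ) * (n + ℓ + d) =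
          (n + 2) * (n + 1) + (n + 2) * (d - 1) - ℓ * (ℓ + d - 2) := by ring
        rw [e]
        simp only [gegenbauerOp, Polynomial.derivative_C_mul, Polynomial.derivative_X_pow,
          show n + 2 - 1 = n + 1 by omega, map_natCast, Nat.cast_add,
          map_mul, map_sub, map_add, Polynomial.C_1]
        simp [Polynomial.C_ofNat]
        ring
      rw [this, zonalPairing_C_mul, map_sub, zonalPairing_C_mul, zonalPairing_C_mul,
        zonalPairing_X_pow, zonalPairing_X_pow, ← hY.integral_inner_pow_add_two hd ω n, sub_self,
        mul_zero]

/-- Since `1 - X²` vanishes at `1`, `gegenbauerOp` maps `(X - 1) ^ (j + 1)` to a combination of only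
that power and the preceding one; orthogonality then gives a two-term recursion. -/
lemma IsSphericalHarmonic.zonalPairing_X_sub_one_pow_succ {d ℓ : ℕ} (hd : 1 ≤ d)
    {Y : C(USphere d, ℂ)} (hY : IsSphericalHarmonic d ℓ Y) (ω : USphere d) (j : ℕ) :
    ((j : ℂ) + 1 - ℓ) * (j + ℓ + d - 1) * zonalPairing Y ω ((Polynomial.X - 1) ^ (j + 1)) =
      -((j + 1) * (2 * j + d - 1)) * zonalPairing Y ω ((Polynomial.X - 1) ^ j) := by
  have h := hY.zonalPairing_gegenbauerOp hd ω ((Polynomial.X - 1) ^ (j + 1))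
  have e : gegenbauerOp d ℓ ((Polynomial.X - 1) ^ (j + 1)) =
      Polynomial.C (-(((j : ℂ) + 1 - ℓ) * (j + ℓ + d - 1))) * (Polynomial.X - 1) ^ (j + 1) -
      Polynomial.C ((((j : ℂ) + 1) * (2 * j + d - 1))) * (Polynomial.X - 1) ^ j := by
    have e : -(((j : ℂ) + 1 - ℓ) * (j + ℓ + d - 1)) =
      -((j + 1) * j + (d - 1) * (j + 1) - ℓ * (ℓ + d - 2)) := by ring
    have e2 : ((j : ℂ) + 1) * (2 * j + d - 1) = (2 * (j * (j + 1)) + (d - 1) * (j + 1)) := by ring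
    rw [e, e2]
    cases j with
    | zero => simp [gegenbauerOp]; ring
    | succ i =>
      simp only [gegenbauerOp, Polynomial.derivative_pow, Polynomial.derivative_mul,
        Polynomial.derivative_X, Polynomial.derivative_one,
        Nat.add_sub_cancel, map_natCast, Polynomial.derivative_natCast, map_mul, map_sub,
        map_add, map_neg, Polynomial.C_1, Polynomial.C_ofNat, Polynomial.derivative_zero]
      push_cast
      ring
  rw [e, map_sub, zonalPairing_C_mul, zonalPairing_C_mul] at h
  linear_combination -h

lemma IsSphericalHarmonic.zonalPairing_X_sub_one_pow_of_lt {d ℓ : ℕ} (hd : 2 ≤ d)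
    {Y : C(USphere d, ℂ)} (hY : IsSphericalHarmonic d ℓ Y) (ω : USphere d) {n : ℕ} (hn : n < ℓ) :
    zonalPairing Y ω ((Polynomial.X - 1) ^ n) = 0 := by
  induction n with
  | zero =>
    rw [pow_zero, ← pow_zero Polynomial.X, zonalPairing_X_pow,
      hY.integral_inner_pow_eq_zero (by omega) ω (fun k => by omega)]
  | succ j ih =>
    have h := hY.zonalPairing_X_sub_one_pow_succ (by omega) ω j
    rw [ih (by omega), mul_zero] at h
    refine (mul_eq_zero.1 h).resolve_left (mul_ne_zero ?_ ?_)
    · rw [sub_ne_zero]; exact_mod_cast hn.ne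
    · have : (j : ℂ) + ℓ + d - 1 = ((j + ℓ + (d - 1) : ℕ) : ℂ) := by
        push_cast [Nat.cast_sub (show 1 ≤ d by omega)]; ring
      rw [this]
      exact_mod_cast (by omega : j + ℓ + (d - 1) ≠ 0)

lemma IsSphericalHarmonic.zonalPairing_X_sub_one_pow_self {d ℓ : ℕ} (hd : 1 ≤ d)
    {Y : C(USphere d, ℂ)} (hY : IsSphericalHarmonic d ℓ Y) (ω : USphere d) :
    zonalPairing Y ω ((Polynomial.X - 1) ^ ℓ) = zonalPairing Y ω (Polynomial.X ^ ℓ) := by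
  rw [sub_eq_add_neg, add_pow, map_sum, Finset.sum_eq_single ℓ]
  · simp
  -- In the binomial expansion all powers of `X` below `ℓ` are orthogonal to `Y`.
  · intro k hk hkℓ
    have : (Polynomial.X : Polynomial ℂ) ^ k * (-1) ^ (ℓ - k) * (ℓ.choose k : Polynomial ℂ) =
        Polynomial.C ((-1) ^ (ℓ - k) * (ℓ.choose k : ℂ)) * Polynomial.X ^ k := by
      simp; ring
    rw [this, zonalPairing_C_mul, zonalPairing_X_pow,
      hY.integral_inner_pow_eq_zero hd ω, mul_zero]
    intro j
    have := Finset.mem_range.1 hk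
    omega
  · simp

/-- The moments of a spherical harmonic centred at the north pole. -/
lemma IsSphericalHarmonic.integral_inner_sub_one_pow {d ℓ : ℕ} (hd : 2 ≤ d)
    {Y : C(USphere d, ℂ)} (hY : IsSphericalHarmonic d ℓ Y) (ω : USphere d) (m : ℕ) :
    ∫ θ : USphere d, (((inner ℝ ω.1 θ.1 : ℝ) : ℂ) - 1) ^ (ℓ + m) * Y θ ∂(surfaceMeasure d) =
      (((2 : ℝ) ^ ((d : ℝ) - 1) * Real.pi ^ (((d : ℝ) - 1) / 2) *
        (2 ^ (ℓ + m) * (-1) ^ m * Real.Gamma (((d : ℝ) - 1) / 2 + ℓ + m) * (ℓ + m).factorial /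
          (Real.Gamma ((d : ℝ) - 1 + 2 * ℓ + m) * m.factorial)) : ℝ) : ℂ) * Y ω := by
  have hd2 : (2 : ℝ) ≤ d := by exact_mod_cast hd
  have key : zonalPairing Y ω ((Polynomial.X - 1) ^ (ℓ + m)) =
      (((2 : ℝ) ^ ((d : ℝ) - 1) * Real.pi ^ (((d : ℝ) - 1) / 2) *
        (2 ^ (ℓ + m) * (-1) ^ m * Real.Gamma (((d : ℝ) - 1) / 2 + ℓ + m) * (ℓ + m).factorial /
          (Real.Gamma ((d : ℝ) - 1 + 2 * ℓ + m) * m.factorial)) : ℝ) : ℂ) * Y ω := by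
    induction m with
    | zero =>
      have h0 := hY.integral_inner_pow (by omega) ω 0
      rw [mul_zero, add_zero] at h0
      rw [add_zero, hY.zonalPairing_X_sub_one_pow_self (by omega), zonalPairing_X_pow, h0]
      congr 2
      have hz : (0 : ℝ) < ((d : ℝ) - 1) / 2 + ℓ := by
        have : (0 : ℝ) ≤ ℓ := by positivity
        linarith
      -- Legendre duplication replaces `Γ(d/2 + ℓ)` from the monomial moment by the ratio of `Γ(d -
      -- 1 + 2ℓ)` and `Γ((d-1)/2 + ℓ)`, which starts the recursion.
      have hdup := Real.Gamma_mul_Gamma_add_half (((d : ℝ) - 1) / 2 + ℓ)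
      rw [show ((d : ℝ) - 1) / 2 + ℓ + 1 / 2 = (d : ℝ) / 2 + ℓ by ring,
        show 2 * (((d : ℝ) - 1) / 2 + ℓ) = (d : ℝ) - 1 + 2 * ℓ by ring,
        show 1 - ((d : ℝ) - 1 + 2 * ℓ) = 1 - ((d : ℝ) - 1) - (2 * ℓ : ℕ) by push_cast; ring,
        Real.rpow_sub (by norm_num), Real.rpow_sub (by norm_num), Real.rpow_natCast,
        Real.rpow_one] at hdup
      have hpi : Real.pi ^ ((d : ℝ) / 2) = Real.pi ^ (((d : ℝ) - 1) / 2) * √Real.pi := by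
        rw [Real.sqrt_eq_rpow, ← Real.rpow_add Real.pi_pos]; congr 1; ring
      have g1 : Real.Gamma ((d : ℝ) / 2 + ℓ) ≠ 0 := (Real.Gamma_pos_of_pos (by positivity)).ne'
      have g2 : Real.Gamma ((d : ℝ) - 1 + 2 * ℓ) ≠ 0 :=
        (Real.Gamma_pos_of_pos (by linarith)).ne'
      have h2 : (2 : ℝ) ^ ((d : ℝ) - 1) ≠ 0 := by positivity
      rw [hpi]
      simp only [CharP.cast_eq_zero, add_zero, Nat.factorial_zero, Nat.cast_one, mul_one, pow_zero]
      rw [pow_mul' (2 : ℝ) 2 ℓ, sq] at hdup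
      field_simp at hdup ⊢
      linear_combination -hdup
    | succ m ih =>
      have h := hY.zonalPairing_X_sub_one_pow_succ (by omega) ω (ℓ + m)
      rw [ih] at h
      have hm : (0 : ℝ) ≤ m := by positivity
      have hl : (0 : ℝ) ≤ ℓ := by positivity
      -- The recursion factor is `(m + 1)(2ℓ + m + d - 1)`, positive for `d ≥ 2`.
      have hne : ((ℓ + m : ℕ) + 1 - ℓ : ℂ) * ((ℓ + m : ℕ) + ℓ + d - 1) ≠ 0 := by
        have : ((ℓ + m : ℕ) + 1 - ℓ : ℝ) * ((ℓ + m : ℕ) + ℓ + d - 1) ≠ 0 := by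
          push_cast
          refine mul_ne_zero ?_ ?_ <;> apply ne_of_gt <;> linarith
        exact_mod_cast this
      rw [← add_assoc]
      refine mul_left_cancel₀ hne ?_
      rw [h, ← mul_assoc, ← mul_assoc]
      congr 1
      have p1 : ((d : ℝ) - 1) / 2 + ℓ + m ≠ 0 := by apply ne_of_gt; linarith
      have p2 : (d : ℝ) - 1 + 2 * ℓ + m ≠ 0 := by apply ne_of_gt; linarith
      have g2 : Real.Gamma ((d : ℝ) - 1 + 2 * ℓ + m) ≠ 0 :=
        (Real.Gamma_pos_of_pos (by linarith)).ne'
      have hmf : (m.factorial : ℝ) ≠ 0 := by exact_mod_cast m.factorial_ne_zero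
      have hm1 : (m : ℝ) + 1 ≠ 0 := by positivity
      have e : -(((ℓ + m : ℕ) + 1) * (2 * (ℓ + m : ℕ) + d - 1) : ℝ) *
        ((2 : ℝ) ^ ((d : ℝ) - 1) * Real.pi ^ (((d : ℝ) - 1) / 2) *
        (2 ^ (ℓ + m) * (-1) ^ m * Real.Gamma (((d : ℝ) - 1) / 2 + ℓ + m) * (ℓ + m).factorial /
          (Real.Gamma ((d : ℝ) - 1 + 2 * ℓ + m) * m.factorial))) =
        ((ℓ + m : ℕ) + 1 - ℓ : ℝ) * ((ℓ + m : ℕ) + ℓ + d - 1) *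
        ((2 : ℝ) ^ ((d : ℝ) - 1) * Real.pi ^ (((d : ℝ) - 1) / 2) *
        (2 ^ (ℓ + m + 1) * (-1) ^ (m + 1) * Real.Gamma (((d : ℝ) - 1) / 2 + ℓ + (m + 1 : ℕ)) *
          (ℓ + m + 1).factorial /
          (Real.Gamma ((d : ℝ) - 1 + 2 * ℓ + (m + 1 : ℕ)) * (m + 1).factorial))) := by
        rw [Nat.cast_succ m, ← add_assoc, ← add_assoc, Real.Gamma_add_one p1,
          Real.Gamma_add_one p2, Nat.factorial_succ, Nat.factorial_succ]
        push_cast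
        generalize (2 : ℝ) ^ ((d : ℝ) - 1) = T
        generalize Real.pi ^ (((d : ℝ) - 1) / 2) = Q
        generalize Real.Gamma (((d : ℝ) - 1) / 2 + ℓ + m) = G₁
        generalize Real.Gamma ((d : ℝ) - 1 + 2 * ℓ + m) = G₂ at g2
        generalize hP : (d : ℝ) - 1 + 2 * ℓ + m = P at p2
        have hdP : (d : ℝ) = P + 1 - 2 * ℓ - m := by linarith
        rw [hdP]
        field_simp
        ring
      exact_mod_cast e
  rw [← key, zonalPairing_apply]
  simp

lemma IsSphericalHarmonic.integral_inner_sub_one_pow_of_lt {d ℓ : ℕ} (hd : 2 ≤ d)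
    {Y : C(USphere d, ℂ)} (hY : IsSphericalHarmonic d ℓ Y) (ω : USphere d) {n : ℕ} (hn : n < ℓ) :
    ∫ θ : USphere d, (((inner ℝ ω.1 θ.1 : ℝ) : ℂ) - 1) ^ n * Y θ ∂(surfaceMeasure d) = 0 := by
  rw [← hY.zonalPairing_X_sub_one_pow_of_lt hd ω hn, zonalPairing_apply]
  simp

/-! ### Rising factorials and Chu–Vandermonde -/

/-- The rising factorial `(a)_n`. -/
def risingFac {R : Type*} [CommRing R] (a : R) (n : ℕ) : R := (ascPochhammer R n).eval a

@[simp] lemma risingFac_zero {R : Type*} [CommRing R] (a : R) : risingFac a 0 = 1 := by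
  simp [risingFac]

lemma risingFac_succ {R : Type*} [CommRing R] (a : R) (n : ℕ) :
    risingFac a (n + 1) = risingFac a n * (a + n) := by
  simp [risingFac, ascPochhammer_succ_right]

lemma risingFac_succ_left {R : Type*} [CommRing R] (a : R) (n : ℕ) :
    risingFac a (n + 1) = a * risingFac (a + 1) n := by
  simp [risingFac, ascPochhammer_succ_left]

lemma risingFac_add {R : Type*} [CommRing R] (a : R) (m n : ℕ) :
    risingFac a (m + n) = risingFac a m * risingFac (a + m) n := by
  induction n with
  | zero => simp
  | succ n ih => rw [← add_assoc, risingFac_succ, ih, risingFac_succ]; push_cast; ring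

lemma risingFac_two_mul (a : ℂ) (k : ℕ) :
    risingFac a (2 * k) = 4 ^ k * (risingFac (a / 2) k * risingFac ((a + 1) / 2) k) := by
  induction k with
  | zero => simp
  | succ k ih =>
    rw [show 2 * (k + 1) = 2 * k + 1 + 1 by ring, risingFac_succ, risingFac_succ, ih,
      risingFac_succ, risingFac_succ]
    push_cast
    ring

/-- The factors of `(1 - a - n)_n` are those of `(a)_n`, negated and in reverse order. -/
lemma neg_one_pow_mul_risingFac (a : ℂ) (n : ℕ) :
    (-1) ^ n * risingFac (1 - a - n) n = risingFac a n := by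
  induction n with
  | zero => simp
  | succ n ih =>
    rw [risingFac_succ a, ← ih, risingFac_succ_left]
    push_cast
    rw [show 1 - a - (n + 1) + 1 = 1 - a - n by ring]
    ring

lemma norm_risingFac_le (a : ℂ) {B : ℝ} (hB : ‖a‖ ≤ B) (n : ℕ) :
    ‖risingFac a n‖ ≤ risingFac B n := by
  have hB0 : 0 ≤ B := (norm_nonneg a).trans hB
  induction n with
  | zero => simp
  | succ n ih =>
    rw [risingFac_succ, risingFac_succ, norm_mul]
    refine mul_le_mul ih ?_ (norm_nonneg _) ((norm_nonneg _).trans ih)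
    refine (norm_add_le _ _).trans ?_
    simpa using hB

lemma risingFac_ofReal (a : ℝ) (n : ℕ) : risingFac (a : ℂ) n = ((risingFac a n : ℝ) : ℂ) := by
  induction n with
  | zero => simp
  | succ n ih => rw [risingFac_succ, risingFac_succ, ih]; push_cast; ring

lemma risingFac_eq_Gamma_div {a : ℂ} (ha : 0 < a.re) (n : ℕ) :
    risingFac a n = Complex.Gamma (a + n) / Complex.Gamma a := by
  rw [Complex.Gamma_add_nat_div_Gamma_eq a, risingFac]
  rintro k rfl
  have : (0 : ℝ) ≤ k := by positivity
  simp at ha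
  linarith

/-- The Chu–Vandermonde identity. -/
lemma chu_vandermonde (n : ℕ) : ∀ a c : ℂ,
    ∑ ij ∈ Finset.HasAntidiagonal.antidiagonal n, (n.choose ij.1 : ℂ) *
      ((-1) ^ ij.1 * risingFac a ij.1 * (Complex.Gamma (c + ij.1))⁻¹) =
      risingFac (c - a) n * (Complex.Gamma (c + n))⁻¹ := by
  induction n with
  | zero => intro a c; simp
  | succ n ih =>
    intro a c
    -- Pascal's rule splits the sum into the one for `(a, c)` and `-a` times the one for `(a + 1, c
    -- + 1)`. Working with `1 / Γ`, for which `1 / Γ(z) = z / Γ(z + 1)` always holds, avoids any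
    -- exclusion of poles.
    rw [Finset.sum_antidiagonal_choose_succ_mul
      (fun i _ => (-1) ^ i * risingFac a i * (Complex.Gamma (c + i))⁻¹), ih a c]
    have h2 : ∑ ij ∈ Finset.HasAntidiagonal.antidiagonal n, (n.choose ij.2 : ℂ) *
        ((-1) ^ (ij.1 + 1) * risingFac a (ij.1 + 1) *
          (Complex.Gamma (c + (ij.1 + 1 : ℕ)))⁻¹) =
        -a * ∑ ij ∈ Finset.HasAntidiagonal.antidiagonal n, (n.choose ij.1 : ℂ) *
      ((-1) ^ ij.1 * risingFac (a + 1) ij.1 * (Complex.Gamma (c + 1 + ij.1))⁻¹) := by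
      rw [Finset.mul_sum]
      refine Finset.sum_congr rfl fun ij hij => ?_
      rw [Nat.choose_symm_of_eq_add (Finset.HasAntidiagonal.mem_antidiagonal.1 hij).symm, risingFac_succ_left]
      push_cast
      rw [show c + ((ij.1 : ℂ) + 1) = c + 1 + ij.1 by ring]
      ring
    rw [h2, ih (a + 1) (c + 1), risingFac_succ, show c + 1 - (a + 1) = c - a by ring]
    have h3 := Complex.one_div_Gamma_eq_self_mul_one_div_Gamma_add_one (c + n)
    push_cast
    rw [show c + 1 + (n : ℂ) = c + n + 1 by ring, show c + ((n : ℂ) + 1) = c + n + 1 by ring, h3]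
    ring

lemma chu_vandermonde_factorial (n : ℕ) (a c : ℂ) :
    ∑ ij ∈ Finset.HasAntidiagonal.antidiagonal n, (-1) ^ ij.1 * risingFac a ij.1 /
      (ij.1.factorial * Complex.Gamma (c + ij.1)) * (1 / ij.2.factorial) =
      risingFac (c - a) n / (n.factorial * Complex.Gamma (c + n)) := by
  have h := chu_vandermonde n a c
  have hn : (n.factorial : ℂ) ≠ 0 := by exact_mod_cast n.factorial_ne_zero
  rw [div_mul_eq_div_div_swap, div_eq_mul_inv (risingFac (c - a) n), ← h, Finset.sum_div]
  refine Finset.sum_congr rfl fun ij hij => ?_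
  have hc : (n.choose ij.1 : ℂ) * (ij.1.factorial * ij.2.factorial) = n.factorial := by
    rw [← Finset.HasAntidiagonal.mem_antidiagonal.1 hij,
      ← Nat.choose_mul_factorial_mul_factorial (Nat.le_add_right ij.1 ij.2),
      Nat.add_sub_cancel_left]
    push_cast; ring
  have h1 : (ij.1.factorial : ℂ) ≠ 0 := by exact_mod_cast ij.1.factorial_ne_zero
  have h2 : (ij.2.factorial : ℂ) ≠ 0 := by exact_mod_cast ij.2.factorial_ne_zero
  rw [← hc, div_mul_eq_div_div_swap, div_eq_mul_inv _ (Complex.Gamma _)]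
  have h3 : (n.choose ij.1 : ℂ) ≠ 0 := by
    intro h0; rw [h0, zero_mul] at hc; exact hn hc.symm
  field_simp

/-! ### Power series of the hypergeometric and binomial functions -/

lemma summable_norm_regularizedHGFun (a b : Multiset ℂ) {z : ℂ}
    (hz : ‖z‖ₑ < (Complex.regularizedHGFunSeries a b).radius) :
    Summable fun n => ‖Complex.regularizedHGFunCoeff a b n * z ^ n‖ := by
  have := (Complex.regularizedHGFunSeries a b).summable_norm_apply (x := z) (by simpa using hz)
  simpa only [Complex.regularizedHGFunSeries, FormalMultilinearSeries.ofScalars_apply_eq,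
    smul_eq_mul] using this

lemma regularizedHGFun_eq_tsum (a b : Multiset ℂ) (z : ℂ) :
    Complex.regularizedHGFun a b z = ∑' n, Complex.regularizedHGFunCoeff a b n * z ^ n := by
  simp only [Complex.regularizedHGFun, FormalMultilinearSeries.sum,
    Complex.regularizedHGFunSeries, FormalMultilinearSeries.ofScalars_apply_eq, smul_eq_mul]

lemma summable_norm_olverM (a b z : ℂ) :
    Summable fun n : ℕ => ‖risingFac a n / (n.factorial * Complex.Gamma (b + n)) * z ^ n‖ := by
  have := summable_norm_regularizedHGFun {a} {b} (z := z)
    (by rw [Complex.radius_regularizedHGFunSeries_eq_top (by simp)]; exact enorm_lt_top)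
  simpa [Complex.regularizedHGFunCoeff, risingFac] using this

lemma olverM_eq_tsum (a b z : ℂ) :
    olverM a b z = ∑' n : ℕ, risingFac a n / (n.factorial * Complex.Gamma (b + n)) * z ^ n := by
  simp [olverM, regularizedHGFun_eq_tsum, Complex.regularizedHGFunCoeff, risingFac]

lemma hasSum_olverM (a b z : ℂ) :
    HasSum (fun n : ℕ => risingFac a n / (n.factorial * Complex.Gamma (b + n)) * z ^ n)
      (olverM a b z) := by
  rw [olverM_eq_tsum]
  exact (summable_norm_olverM a b z).of_norm.hasSum

lemma continuous_olverM (a b : ℂ) : Continuous (olverM a b) := by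
  have hr := Complex.radius_regularizedHGFunSeries_eq_top (a := {a}) (b := {b}) (by simp)
  have h := (Complex.regularizedHGFunSeries {a} {b}).hasFPowerSeriesOnBall (by rw [hr]; simp)
  rw [hr] at h
  have := h.continuousOn
  rw [Metric.eball_top] at this
  exact continuousOn_univ.1 this

lemma summable_norm_gauss (a b c : ℂ) {z : ℂ} (hz : ‖z‖ < 1) :
    Summable fun n : ℕ =>
      ‖risingFac a n * risingFac b n / (n.factorial * Complex.Gamma (c + n)) * z ^ n‖ := by
  have := summable_norm_regularizedHGFun {a, b} {c} (z := z)
    (lt_of_lt_of_le (by simpa [enorm_eq_nnnorm, ← NNReal.coe_lt_coe] using hz)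
      (Complex.radius_regularizedGaussHGFunSeries_ge_one a b c))
  simpa [Complex.regularizedHGFunCoeff, risingFac] using this

lemma gauss_eq_tsum (a b c z : ℂ) :
    Complex.regularizedGaussHGFun a b c z = ∑' n : ℕ,
      risingFac a n * risingFac b n / (n.factorial * Complex.Gamma (c + n)) * z ^ n := by
  rw [Complex.regularizedGaussHGFun, Complex.regularizedGaussHGFunSeries,
    ← Complex.regularizedHGFun, regularizedHGFun_eq_tsum]
  simp [Complex.regularizedHGFunCoeff, risingFac]

lemma hasSum_gauss (a b c : ℂ) {z : ℂ} (hz : ‖z‖ < 1) :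
    HasSum (fun n : ℕ =>
      risingFac a n * risingFac b n / (n.factorial * Complex.Gamma (c + n)) * z ^ n)
      (Complex.regularizedGaussHGFun a b c z) := by
  rw [gauss_eq_tsum]
  exact (summable_norm_gauss a b c hz).of_norm.hasSum

lemma analyticAt_gauss (a b c : ℂ) {z : ℂ} (hz : ‖z‖ < 1) :
    AnalyticAt ℂ (Complex.regularizedGaussHGFun a b c) z := by
  have hr := Complex.radius_regularizedGaussHGFunSeries_ge_one a b c
  have h := (Complex.regularizedGaussHGFunSeries a b c).hasFPowerSeriesOnBall
    (lt_of_lt_of_le (by simp) hr)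
  refine h.analyticAt_of_mem ?_
  rw [mem_eball_zero_iff]
  exact lt_of_lt_of_le (by simpa [enorm_eq_nnnorm, ← NNReal.coe_lt_coe] using hz) hr

lemma summable_norm_binomial_and_hasSum (β : ℂ) {q : ℂ} (hq : ‖q‖ < 1) :
    (Summable fun j : ℕ => ‖risingFac β j / j.factorial * q ^ j‖) ∧
    HasSum (fun j : ℕ => risingFac β j / j.factorial * q ^ j) ((1 - q) ^ (-β)) := by
  have h := Complex.one_div_one_sub_cpow_hasFPowerSeriesOnBall_zero β
  have hq' : q ∈ Metric.eball (0 : ℂ) 1 := by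
    simpa [enorm_eq_nnnorm, ← NNReal.coe_lt_coe] using hq
  have hc : ∀ j : ℕ, Ring.choose (β + j - 1) j = risingFac β j / j.factorial := by
    intro j
    have hj : (j.factorial : ℂ) ≠ 0 := by exact_mod_cast j.factorial_ne_zero
    rw [← Ring.multichoose_eq, eq_div_iff hj, risingFac,
      ← Polynomial.ascPochhammer_smeval_eq_eval, ← Ring.factorial_nsmul_multichoose_eq_ascPochhammer,
      nsmul_eq_mul, mul_comm]
  have h2 := h.hasSum hq'
  simp only [FormalMultilinearSeries.ofScalars_apply_eq, hc, smul_eq_mul, zero_add] at h2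
  rw [one_div, ← Complex.cpow_neg] at h2
  refine ⟨?_, h2⟩
  have := FormalMultilinearSeries.summable_norm_apply _ (Metric.eball_subset_eball h.r_le hq')
  simpa only [FormalMultilinearSeries.ofScalars_apply_eq, hc, smul_eq_mul] using this

lemma hasSum_real_binomial (B : ℝ) {x : ℝ} (hx0 : 0 ≤ x) (hx : x < 1) :
    HasSum (fun j : ℕ => risingFac B j / j.factorial * x ^ j) ((1 - x) ^ (-B)) := by
  have h := (summable_norm_binomial_and_hasSum (B : ℂ) (q := (x : ℂ))
    (by rwa [Complex.norm_real, Real.norm_of_nonneg hx0])).2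
  rw [← Complex.hasSum_ofReal, Complex.ofReal_cpow (by linarith)]
  push_cast
  simpa only [risingFac_ofReal] using h

/-- Regroups a double series by total degree, as needed to read off coefficients of `q ^ n`. -/
lemma hasSum_antidiagonal_of_hasSum_prod {F : ℕ × ℕ → ℂ} {S : ℂ} (h : HasSum F S) :
    HasSum (fun n => ∑ ij ∈ Finset.HasAntidiagonal.antidiagonal n, F ij) S := by
  have h1 := (Finset.HasAntidiagonal.sigmaAntidiagonalEquivProd (A := ℕ)).hasSum_iff.2 h
  refine h1.sigma fun n => ?_
  have h2 := hasSum_fintype (fun x : Finset.HasAntidiagonal.antidiagonal n => F x.1)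
  rw [Finset.sum_coe_sort (Finset.HasAntidiagonal.antidiagonal n) F] at h2
  exact h2

/-- Re-expansion of `(1 - q)^{-β} ∑ₖ αₖ (σ q / (1 - q)^m)^k` in powers of `q`. -/
lemma hasSum_binomial_comp (α : ℕ → ℂ) (β σ : ℂ) {q : ℂ} (m : ℕ) (hq : ‖q‖ < 1)
    (hs : Summable fun k => ‖α k‖ * (‖σ‖ * ‖q‖ / (1 - ‖q‖) ^ m) ^ k) :
    HasSum (fun n => (∑ ij ∈ Finset.HasAntidiagonal.antidiagonal n,
        α ij.1 * σ ^ ij.1 * (risingFac (β + m * ij.1) ij.2 / ij.2.factorial)) * q ^ n)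
      ((1 - q) ^ (-β) * ∑' k, α k * (σ * q / (1 - q) ^ m) ^ k) := by
  have hq1 : 0 < 1 - ‖q‖ := by linarith
  have hq0 : 1 - q ≠ 0 := by
    intro h
    rw [← sub_eq_zero.1 h] at hq
    simp at hq
  -- Row `k` is the binomial expansion of `(1 - q) ^ (-β - m k)`, multiplied by `α k (σ q) ^ k`.
  set F : ℕ × ℕ → ℂ := fun ij => α ij.1 * (σ * q) ^ ij.1 *
    (risingFac (β + m * ij.1) ij.2 / ij.2.factorial * q ^ ij.2) with hF
  have hrow : ∀ k, HasSum (fun j => F (k, j))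
      ((1 - q) ^ (-β) * (α k * (σ * q / (1 - q) ^ m) ^ k)) := by
    intro k
    have h := ((summable_norm_binomial_and_hasSum (β + m * k) hq).2).mul_left (α k * (σ * q) ^ k)
    convert! h using 1
    rw [neg_add, ← sub_eq_add_neg, Complex.cpow_sub _ _ hq0,
      show (m : ℂ) * k = ((m * k : ℕ) : ℂ) by push_cast; ring, Complex.cpow_natCast, pow_mul,
      div_pow]
    ring
  -- Replacing `β`, `σ`, `q` and `α k` by their norms gives a nonnegative majorant whose rows again
  -- sum by the binomial series; hypothesis `hs` sums the rows.
  have hsum : Summable fun ij => ‖F ij‖ := by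
    rw [summable_prod_of_nonneg (fun _ => norm_nonneg _)]
    have hreal : ∀ k : ℕ, HasSum (fun j : ℕ => ‖α k‖ * (‖σ‖ * ‖q‖) ^ k *
        (risingFac (‖β‖ + m * k) j / j.factorial * ‖q‖ ^ j))
        (‖α k‖ * (‖σ‖ * ‖q‖) ^ k * (1 - ‖q‖) ^ (-(‖β‖ + m * k))) := fun k =>
      (hasSum_real_binomial _ (norm_nonneg q) hq).mul_left _
    have hle : ∀ k j : ℕ, ‖F (k, j)‖ ≤ ‖α k‖ * (‖σ‖ * ‖q‖) ^ k *
        (risingFac (‖β‖ + m * k) j / j.factorial * ‖q‖ ^ j) := by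
      intro k j
      simp only [hF, norm_mul, norm_pow, norm_div, Complex.norm_natCast]
      gcongr
      refine norm_risingFac_le _ ((norm_add_le _ _).trans ?_) j
      simp
    have hrows : ∀ k, Summable fun j => ‖F (k, j)‖ := fun k =>
      Summable.of_nonneg_of_le (fun _ => norm_nonneg _) (hle k) (hreal k).summable
    refine ⟨hrows, ?_⟩
    refine Summable.of_nonneg_of_le (fun k => tsum_nonneg fun _ => norm_nonneg _)
      (fun k => (((hrows k).tsum_le_tsum (hle k) (hreal k).summable).trans_eq (hreal k).tsum_eq))
      ((hs.mul_left ((1 - ‖q‖) ^ (-‖β‖))).congr fun k => ?_)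
    rw [neg_add, ← sub_eq_add_neg, Real.rpow_sub hq1,
      show (m : ℝ) * k = ((m * k : ℕ) : ℝ) by push_cast; ring, Real.rpow_natCast, pow_mul, div_pow]
    ring
  have htot : HasSum F ((1 - q) ^ (-β) * ∑' k, α k * (σ * q / (1 - q) ^ m) ^ k) := by
    have h1 := hsum.of_norm.hasSum
    have h2 := h1.prod_fiberwise hrow
    rw [← tsum_mul_left, h2.tsum_eq]
    exact h1
  convert hasSum_antidiagonal_of_hasSum_prod htot using 2 with n
  rw [Finset.sum_mul]
  refine Finset.sum_congr rfl fun ij hij => ?_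
  rw [← Finset.HasAntidiagonal.mem_antidiagonal.1 hij, hF]
  simp only [mul_pow, pow_add]
  ring

/-! ### Kummer, Pfaff, quadratic and Euler transformations -/

/-- Kummer's transformation. -/
lemma olverM_kummer (a b z : ℂ) : olverM a b z = Complex.exp z * olverM (b - a) b (-z) := by
  have hexp : Summable fun n : ℕ => ‖z ^ n / n.factorial‖ :=
    NormedSpace.norm_expSeries_div_summable z
  have he : Complex.exp z = ∑' n : ℕ, z ^ n / n.factorial := by
    rw [Complex.exp_eq_exp_ℂ, NormedSpace.exp_eq_tsum_div]
  rw [mul_comm, he, olverM_eq_tsum (b - a), tsum_mul_tsum_eq_tsum_sum_antidiagonal_of_summable_norm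
    (summable_norm_olverM _ _ _) hexp, olverM_eq_tsum]
  refine tsum_congr fun n => ?_
  -- With parameter `b - a` the right side of Chu–Vandermonde is `(a)_n`, so the Cauchy product has
  -- the coefficients of `olverM a b`.
  have h := chu_vandermonde_factorial n (b - a) b
  rw [sub_sub_cancel] at h
  rw [← h, Finset.sum_mul]
  refine Finset.sum_congr rfl fun ij hij => ?_
  rw [← Finset.HasAntidiagonal.mem_antidiagonal.1 hij, neg_pow, pow_add]
  ring

/-- Pfaff's transformation. -/
lemma gauss_pfaff (a b c : ℂ) {q : ℂ} (hq : ‖q‖ < 1 / 2) :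
    Complex.regularizedGaussHGFun a b c q =
      (1 - q) ^ (-b) * Complex.regularizedGaussHGFun (c - a) b c (-q / (1 - q)) := by
  have hq1 : 0 < 1 - ‖q‖ := by linarith
  have hx : ‖q‖ / (1 - ‖q‖) < 1 := by rw [div_lt_one hq1]; linarith
  -- The choice `σ = -1`, `m = 1` gives the inner argument `-q / (1 - q)`; the bound `‖q‖ < 1/2`
  -- makes its majorant less than `1`.
  have h := hasSum_binomial_comp
    (fun k => risingFac (c - a) k * risingFac b k / (k.factorial * Complex.Gamma (c + k)))
    b (-1) 1 (q := q) (by linarith) (by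
      have := summable_norm_gauss (c - a) b c (z := ((‖q‖ / (1 - ‖q‖) : ℝ) : ℂ))
        (by rwa [Complex.norm_real, Real.norm_of_nonneg (by positivity)])
      refine this.congr fun k => ?_
      rw [norm_mul, norm_pow, Complex.norm_real, Real.norm_of_nonneg (by positivity)]
      simp)
  have h2 := hasSum_gauss a b c (z := q) (by linarith)
  rw [gauss_eq_tsum (c - a)]
  have h3 : ∀ k : ℕ, (-1 * q / (1 - q) ^ 1) ^ k = (-q / (1 - q)) ^ k := by
    intro k; rw [pow_one, neg_one_mul]
  simp only [h3] at h
  refine h2.unique ?_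
  convert h using 3 with n
  have hcv := chu_vandermonde_factorial n (c - a) c
  rw [sub_sub_cancel] at hcv
  rw [mul_comm (risingFac a n), mul_div_assoc, ← hcv, Finset.mul_sum]
  refine Finset.sum_congr rfl fun ij hij => ?_
  rw [← Finset.HasAntidiagonal.mem_antidiagonal.1 hij, risingFac_add]
  simp only [Nat.cast_one, one_mul]
  ring

/-- For `‖q‖ ≤ 1/9` the majorant `4‖q‖ / (1 - ‖q‖)²` of the inner argument is at most `9/16`, so the
double series converges absolutely and coefficients can be compared. -/
lemma gauss_quadratic_of_norm_le (s c : ℂ) {q : ℂ} (hq : ‖q‖ ≤ 1 / 9) :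
    Complex.regularizedGaussHGFun s (s + 1 - c) c q =
      (1 + q) ^ (-s) *
        Complex.regularizedGaussHGFun (s / 2) ((s + 1) / 2) c (4 * q / (1 + q) ^ 2) := by
  have hq1 : 0 < 1 - ‖q‖ := by linarith
  have hx : 4 * ‖q‖ / (1 - ‖q‖) ^ 2 < 1 := by
    rw [div_lt_one (by positivity)]; nlinarith [norm_nonneg q]
  -- Applied at `-q` with `σ = -4`, `m = 2`, so that the inner argument is `4q / (1 + q)²`.
  have h := hasSum_binomial_comp
    (fun k => risingFac (s / 2) k * risingFac ((s + 1) / 2) k /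
      (k.factorial * Complex.Gamma (c + k)))
    s (-4) 2 (q := -q) (by rw [norm_neg]; linarith) (by
      have := summable_norm_gauss (s / 2) ((s + 1) / 2) c
        (z := ((4 * ‖q‖ / (1 - ‖q‖) ^ 2 : ℝ) : ℂ))
        (by rwa [Complex.norm_real, Real.norm_of_nonneg (by positivity)])
      refine this.congr fun k => ?_
      rw [norm_mul, norm_pow, Complex.norm_real, Real.norm_of_nonneg (by positivity)]
      simp)
  have h2 := hasSum_gauss s (s + 1 - c) c (z := q) (by linarith)
  rw [gauss_eq_tsum (s / 2)]
  simp only [sub_neg_eq_add, neg_mul_neg] at h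
  refine h2.unique ?_
  convert! h using 2 with n
  rw [neg_pow q, ← mul_assoc]
  congr 1
  -- The parameter `s + n` works because `(s)_n (s + n)_k = (s)_(2k) (s + 2k)_(n - k)`, where
  -- duplication splits `(s)_(2k)`; reversal turns the resulting `(c - s - n)_n` into `(s + 1 -
  -- c)_n`.
  have hcv := chu_vandermonde_factorial n (s + n) c
  have e := neg_one_pow_mul_risingFac (s + 1 - c) n
  rw [show 1 - (s + 1 - c) - n = c - (s + n) by ring] at e
  rw [← e, show risingFac s n * ((-1) ^ n * risingFac (c - (s + n)) n) /
      (n.factorial * Complex.Gamma (c + n)) = (risingFac s n * (risingFac (c - (s + n)) n /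
      (n.factorial * Complex.Gamma (c + n)))) * (-1) ^ n by ring, ← hcv, Finset.mul_sum]
  congr 1
  refine Finset.sum_congr rfl fun ij hij => ?_
  have e1 : risingFac s n * risingFac (s + n) ij.1 =
      4 ^ ij.1 * (risingFac (s / 2) ij.1 * risingFac ((s + 1) / 2) ij.1) *
        risingFac (s + 2 * ij.1) ij.2 := by
    rw [← risingFac_two_mul, ← risingFac_add, show (2 : ℂ) * ij.1 = ((2 * ij.1 : ℕ) : ℂ) by simp,
      ← risingFac_add]
    congr 1
    have := Finset.HasAntidiagonal.mem_antidiagonal.1 hij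
    omega
  rw [show risingFac s n * ((-1) ^ ij.1 * risingFac (s + n) ij.1 /
      (ij.1.factorial * Complex.Gamma (c + ij.1)) * (1 / ij.2.factorial)) =
      (-1) ^ ij.1 * (risingFac s n * risingFac (s + n) ij.1) /
      (ij.1.factorial * Complex.Gamma (c + ij.1)) * (1 / ij.2.factorial) by ring, e1,
    neg_pow (4 : ℂ)]
  push_cast
  ring

/-- Analytic continuation along `(0, 1)`. -/
lemma eq_of_analyticAt_Ioo {f g : ℂ → ℂ} (hf : ∀ q ∈ Set.Ioo (0 : ℝ) 1, AnalyticAt ℂ f q)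
    (hg : ∀ q ∈ Set.Ioo (0 : ℝ) 1, AnalyticAt ℂ g q) {ε : ℝ} (hε : 0 < ε) (hε1 : ε ≤ 1)
    (h : ∀ q ∈ Set.Ioo (0 : ℝ) ε, f q = g q) {q : ℝ} (hq : q ∈ Set.Ioo (0 : ℝ) 1) : f q = g q := by
  -- Restricted to the real line both functions are real-analytic on the connected interval, so the
  -- identity theorem applies there.
  have hres : ∀ {f : ℂ → ℂ}, (∀ q ∈ Set.Ioo (0 : ℝ) 1, AnalyticAt ℂ f q) →
      AnalyticOnNhd ℝ (fun q : ℝ => f q) (Set.Ioo 0 1) := fun hf q hq =>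
    ((hf q hq).restrictScalars (𝕜 := ℝ)).comp (Complex.ofRealCLM.analyticAt q)
  refine (hres hf).eqOn_of_preconnected_of_eventuallyEq (hres hg) isPreconnected_Ioo
    (z₀ := ε / 2) ⟨by linarith, by linarith⟩ ?_ hq
  filter_upwards [Ioo_mem_nhds (show 0 < ε / 2 by linarith) (show ε / 2 < ε by linarith)] with x hx
  exact h x hx

lemma one_sub_mem_slitPlane {q : ℝ} (hq : q ∈ Set.Ioo (0 : ℝ) 1) :
    1 - (q : ℂ) ∈ Complex.slitPlane := by
  left; simpa using hq.2

lemma norm_ofReal_lt_one {q : ℝ} (hq : q ∈ Set.Ioo (0 : ℝ) 1) : ‖(q : ℂ)‖ < 1 := by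
  rw [Complex.norm_real, Real.norm_of_nonneg hq.1.le]; exact hq.2

/-- A quadratic transformation of the hypergeometric function. -/
lemma gauss_quadratic (s c : ℂ) {q : ℝ} (hq : q ∈ Set.Ioo (0 : ℝ) 1) :
    Complex.regularizedGaussHGFun s (s + 1 - c) c q =
      (1 + q) ^ (-s) *
        Complex.regularizedGaussHGFun (s / 2) ((s + 1) / 2) c (4 * q / (1 + q) ^ 2) := by
  refine eq_of_analyticAt_Ioo (f := Complex.regularizedGaussHGFun s (s + 1 - c) c)
    (g := fun q => (1 + q) ^ (-s) *
        Complex.regularizedGaussHGFun (s / 2) ((s + 1) / 2) c (4 * q / (1 + q) ^ 2))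
    (fun q hq => analyticAt_gauss _ _ _ (norm_ofReal_lt_one hq)) (fun q hq => ?_)
    (ε := 1 / 9) (by norm_num) (by norm_num) (fun q hq => ?_) hq
  · have h1 : (1 : ℂ) + q ∈ Complex.slitPlane := by
      left; simpa using by linarith [hq.1]
    have h2 : (1 : ℂ) + q ≠ 0 := Complex.slitPlane_ne_zero h1
    have h3 : ‖4 * (q : ℂ) / (1 + q) ^ 2‖ < 1 := by
      have : 4 * (q : ℂ) / (1 + q) ^ 2 = ((4 * q / (1 + q) ^ 2 : ℝ) : ℂ) := by push_cast; rfl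
      have hq0 := hq.1
      rw [this, Complex.norm_real, Real.norm_of_nonneg (by positivity),
        div_lt_one (by positivity)]
      nlinarith [hq.2, sq_pos_of_pos (sub_pos.2 hq.2)]
    refine AnalyticAt.mul ?_ ?_
    · exact (analyticAt_const.add analyticAt_id).cpow analyticAt_const h1
    · refine AnalyticAt.fun_comp (g := Complex.regularizedGaussHGFun (s / 2) ((s + 1) / 2) c)
        (f := fun q : ℂ => 4 * q / (1 + q) ^ 2) (analyticAt_gauss _ _ _ h3) ?_
      exact (analyticAt_const.mul analyticAt_id).div
        ((analyticAt_const.add analyticAt_id).pow 2) (pow_ne_zero 2 h2)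
  · refine gauss_quadratic_of_norm_le s c ?_
    rw [Complex.norm_real, Real.norm_of_nonneg hq.1.le]
    exact hq.2.le

/-- Euler's transformation. -/
lemma gauss_euler (a b c : ℂ) {q : ℝ} (hq : q ∈ Set.Ioo (0 : ℝ) 1) :
    Complex.regularizedGaussHGFun a b c q =
      (1 - q) ^ (c - a - b) * Complex.regularizedGaussHGFun (c - a) (c - b) c q := by
  refine eq_of_analyticAt_Ioo (f := Complex.regularizedGaussHGFun a b c)
    (g := fun q => (1 - q) ^ (c - a - b) * Complex.regularizedGaussHGFun (c - a) (c - b) c q)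
    (fun q hq => analyticAt_gauss _ _ _ (norm_ofReal_lt_one hq)) (fun q hq => ?_)
    (ε := 1 / 4) (by norm_num) (by norm_num) (fun q hq => ?_) hq
  · exact ((analyticAt_const.sub analyticAt_id).cpow analyticAt_const
      (one_sub_mem_slitPlane hq)).mul (analyticAt_gauss _ _ _ (norm_ofReal_lt_one hq))
  · have hq0 := hq.1
    have hq4 := hq.2
    have h1 : (1 : ℂ) - q ≠ 0 := by
      have : (1 : ℝ) - q ≠ 0 := by linarith
      exact_mod_cast this
    have hn : ‖-(q : ℂ) / (1 - q)‖ < 1 / 2 := by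
      have : -(q : ℂ) / (1 - q) = ((-(q / (1 - q)) : ℝ) : ℂ) := by push_cast; ring
      rw [this, Complex.norm_real, norm_neg,
        Real.norm_of_nonneg (div_nonneg hq0.le (by linarith)), div_lt_iff₀ (by linarith)]
      linarith
    -- Pfaff's map `q ↦ -q / (1 - q)` is an involution: applying the transformation twice, once in
    -- each upper parameter, returns to `q`. For `q < 1/4` both applications are in range.
    rw [gauss_pfaff a b c (q := (q : ℂ))
        (by rw [Complex.norm_real, Real.norm_of_nonneg hq0.le]; linarith),
      Complex.regularizedGaussHGFun_symm, gauss_pfaff b (c - a) c hn]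
    have e1 : 1 - -(q : ℂ) / (1 - q) = (1 - (q : ℂ))⁻¹ := by field_simp; ring
    have e2 : - (-(q : ℂ) / (1 - q)) / (1 - (q : ℂ))⁻¹ = q := by field_simp
    have e3 : ((1 : ℂ) - q)⁻¹ ^ (-(c - a)) = (1 - q) ^ (c - a) := by
      have harg : ((1 : ℂ) - q).arg ≠ Real.pi := by
        rw [show (1 : ℂ) - q = ((1 - q : ℝ) : ℂ) by push_cast; rfl,
          Complex.arg_ofReal_of_nonneg (by linarith)]
        exact Real.pi_ne_zero.symm
      rw [Complex.inv_cpow _ _ harg, Complex.cpow_neg, inv_inv]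
    rw [e1, e2, e3, ← mul_assoc, ← Complex.cpow_add _ _ h1, Complex.regularizedGaussHGFun_symm]
    congr 2
    ring

/-! ### Termwise integration and the Coulomb Poisson operator -/

lemma toL2Sphere_ae_eq (d : ℕ) (Y : C(USphere d, ℂ)) :
    toL2Sphere d Y =ᵐ[surfaceMeasure d] Y :=
  ContinuousMap.coeFn_toLp (surfaceMeasure d) Y

lemma hasSum_integral_series {d : ℕ} {c : ℕ → ℂ} {g : USphere d → ℂ} (hg : Continuous g) {ρ : ℝ}
    (hρ : ∀ θ, ‖g θ‖ ≤ ρ) (hs : Summable fun n => ‖c n‖ * ρ ^ n) (Y : C(USphere d, ℂ)) :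
    HasSum (fun n => c n * ∫ θ, g θ ^ n * Y θ ∂(surfaceMeasure d))
      (∫ θ, (∑' n, c n * g θ ^ n) * Y θ ∂(surfaceMeasure d)) := by
  have hint : ∀ n, Integrable (fun θ => c n * g θ ^ n * Y θ) (surfaceMeasure d) := fun n =>
    integrable_of_continuous_sphere (by fun_prop)
  have h := hasSum_integral_of_summable_integral_norm (μ := surfaceMeasure d)
    (F := fun n θ => c n * g θ ^ n * Y θ) hint ?_
  · convert! h using 1
    · funext n
      rw [← integral_const_mul]
      simp only [mul_assoc]
    · simp only [tsum_mul_right]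
  · refine Summable.of_nonneg_of_le (fun n => integral_nonneg fun θ => norm_nonneg _) (fun n => ?_)
      (hs.mul_right (‖Y‖ * (surfaceMeasure d).real Set.univ))
    calc ∫ θ, ‖c n * g θ ^ n * Y θ‖ ∂(surfaceMeasure d)
        ≤ ∫ _, ‖c n‖ * ρ ^ n * ‖Y‖ ∂(surfaceMeasure d) := by
          refine integral_mono (hint n).norm (integrable_const _) fun θ => ?_
          simp only [norm_mul, norm_pow]
          have h1 := hρ θ
          have h2 := Y.norm_coe_le_norm θ
          have : 0 ≤ ρ := (norm_nonneg _).trans h1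
          gcongr
      _ = _ := by rw [integral_const, smul_eq_mul]; ring

lemma abs_inner_sphere_le_one {d : ℕ} (ω θ : USphere d) : |inner ℝ ω.1 θ.1| ≤ 1 := by
  have := abs_real_inner_le_norm ω.1 θ.1
  simpa using this

lemma continuous_inner_sphere {d : ℕ} (ω : USphere d) :
    Continuous fun θ : USphere d => ((inner ℝ ω.1 θ.1 : ℝ) : ℂ) := by fun_prop

/-- Kummer's transformation produces the exponent `i (|x| - x·θ) / (ħ²λ)`, which cancels the
`θ`-dependence of the plane-wave phase and leaves a series in `ω · θ - 1`. -/
lemma coulombPlaneWave_eq (d : ℕ) (hbar lam : ℝ) {r : ℝ} (hr : 0 ≤ r) (ω θ : USphere d) :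
    coulombPlaneWave d hbar lam (r • ω.1) θ =
      (coulombConst d hbar lam : ℂ) * Complex.exp (Complex.I * r / (hbar ^ 2 * lam)) *
        olverM (((d : ℂ) - 1) / 2 - Complex.I * lam) (((d : ℂ) - 1) / 2)
          (Complex.I * r / (hbar ^ 2 * lam) * (((inner ℝ ω.1 θ.1 : ℝ) : ℂ) - 1)) := by
  have hn : ‖r • ω.1‖ = r := by rw [norm_smul, Real.norm_of_nonneg hr]; simp
  rw [coulombPlaneWave, olverM_kummer, hn, real_inner_smul_left, mul_assoc, mul_assoc,
    ← mul_assoc (Complex.exp _), ← Complex.exp_add]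
  congr 3
  · push_cast; ring
  · push_cast; ring

lemma continuous_coulombPlaneWave (d : ℕ) (hbar lam : ℝ) (x : EuclideanSpace ℝ (Fin d)) :
    Continuous (coulombPlaneWave d hbar lam x) := by
  unfold coulombPlaneWave
  have := continuous_olverM (Complex.I * lam) (((d : ℂ) - 1) / 2)
  fun_prop

lemma integral_olverM_mul_sphericalHarmonic {d ℓ : ℕ} (hd : 2 ≤ d) {Y : C(USphere d, ℂ)}
    (hY : IsSphericalHarmonic d ℓ Y) (ω : USphere d) (a z : ℂ) :
    ∫ θ : USphere d, olverM a (((d : ℂ) - 1) / 2) (z * (((inner ℝ ω.1 θ.1 : ℝ) : ℂ) - 1)) * Y θ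
      ∂(surfaceMeasure d) =
      (((2 : ℝ) ^ ((d : ℝ) - 1) * Real.pi ^ (((d : ℝ) - 1) / 2) : ℝ) : ℂ) * risingFac a ℓ *
        (2 * z) ^ ℓ * olverM (a + ℓ) ((d : ℂ) - 1 + 2 * ℓ) (-(2 * z)) * Y ω := by
  have hd2 : (2 : ℝ) ≤ d := by exact_mod_cast hd
  set b : ℂ := ((d : ℂ) - 1) / 2 with hb
  have hser := hasSum_integral_series
    (c := fun n => risingFac a n / (n.factorial * Complex.Gamma (b + n)) * z ^ n)
    (g := fun θ : USphere d => ((inner ℝ ω.1 θ.1 : ℝ) : ℂ) - 1)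
    ((continuous_inner_sphere ω).sub continuous_const) (ρ := 2) (fun θ => by
      refine (norm_sub_le _ _).trans ?_
      have := abs_inner_sphere_le_one ω θ
      rw [Complex.norm_real, Real.norm_eq_abs, norm_one]
      linarith)
    (by
      refine (summable_norm_olverM a b (2 * z)).congr fun n => ?_
      simp only [norm_mul, norm_pow, Complex.norm_ofNat, mul_pow]
      ring) Y
  have hl : ∀ θ : USphere d, olverM a b (z * (((inner ℝ ω.1 θ.1 : ℝ) : ℂ) - 1)) =
      ∑' n : ℕ, risingFac a n / (n.factorial * Complex.Gamma (b + n)) * z ^ n *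
        (((inner ℝ ω.1 θ.1 : ℝ) : ℂ) - 1) ^ n := by
    intro θ
    rw [olverM_eq_tsum]
    simp only [mul_pow, mul_assoc]
  simp only [hl]
  refine hser.unique ?_
  -- The terms with `n < ℓ` vanish; re-indexing by `n = ℓ + m` produces the shifted parameters.
  rw [← (add_right_injective ℓ).hasSum_iff]
  · have h2 := ((hasSum_olverM (a + ℓ) ((d : ℂ) - 1 + 2 * ℓ) (-(2 * z))).mul_left
      ((((2 : ℝ) ^ ((d : ℝ) - 1) * Real.pi ^ (((d : ℝ) - 1) / 2) : ℝ) : ℂ) * risingFac a ℓ *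
        (2 * z) ^ ℓ)).mul_right (Y ω)
    refine h2.congr_fun fun m => ?_
    rw [Function.comp_apply, hY.integral_inner_sub_one_pow hd ω m]
    have hl0 : (0 : ℝ) ≤ ℓ := by positivity
    have hm0 : (0 : ℝ) ≤ m := by positivity
    have g1 : (Real.Gamma (((d : ℝ) - 1) / 2 + ℓ + m) : ℂ) ≠ 0 := by
      exact Complex.ofReal_ne_zero.2 (Real.Gamma_pos_of_pos (by linarith)).ne'
    have e1 : Complex.Gamma (b + (ℓ + m : ℕ)) = (Real.Gamma (((d : ℝ) - 1) / 2 + ℓ + m) : ℂ) := by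
      rw [← Complex.Gamma_ofReal, hb]; congr 1; push_cast; ring
    have e2 : Complex.Gamma ((d : ℂ) - 1 + 2 * ℓ + m) =
        (Real.Gamma ((d : ℝ) - 1 + 2 * ℓ + m) : ℂ) := by
      rw [← Complex.Gamma_ofReal]; congr 1; push_cast; ring
    have hf : ((ℓ + m).factorial : ℂ) ≠ 0 := by exact_mod_cast (ℓ + m).factorial_ne_zero
    rw [e1, e2, risingFac_add]
    push_cast
    generalize (Real.Gamma (((d : ℝ) - 1) / 2 + ℓ + m) : ℂ) = G at g1
    rw [neg_pow (2 * z), mul_pow, mul_pow, pow_add z, pow_add (2 : ℂ)]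
    field_simp
  · intro n hn
    rw [hY.integral_inner_sub_one_pow_of_lt hd ω, mul_zero]
    by_contra h
    exact hn ⟨n - ℓ, by simp only; omega⟩

/-- The Coulomb Poisson operator on spherical harmonics. -/
lemma coulombPoisson_sphericalHarmonic {d ℓ : ℕ} (hd : 2 ≤ d) (hbar lam : ℝ) {Y : C(USphere d, ℂ)}
    (hY : IsSphericalHarmonic d ℓ Y) (x : EuclideanSpace ℝ (Fin d)) (ω : USphere d)
    (hx : x = ‖x‖ • ω.1) :
    coulombPoisson d hbar lam (toL2Sphere d Y) x =
        ((coulombConst d hbar lam * (2 : ℝ) ^ ((d : ℝ) - 1) *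
            Real.pi ^ (((d : ℝ) - 1) / 2) : ℝ) : ℂ) *
          Complex.Gamma (((d : ℂ) - 1) / 2 + ℓ - Complex.I * lam) /
          Complex.Gamma (((d : ℂ) - 1) / 2 - Complex.I * lam) *
          (2 * Complex.I * ‖x‖ / (hbar ^ 2 * lam)) ^ ℓ *
          Complex.exp (Complex.I * ‖x‖ / (hbar ^ 2 * lam)) *
          olverM (((d : ℂ) - 1) / 2 + ℓ - Complex.I * lam) ((d : ℂ) - 1 + 2 * ℓ)
            (-(2 * Complex.I * ‖x‖ / (hbar ^ 2 * lam))) *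
          Y ω := by
  have hd2 : (2 : ℝ) ≤ d := by exact_mod_cast hd
  have h1 : coulombPoisson d hbar lam (toL2Sphere d Y) x =
      ∫ θ, coulombPlaneWave d hbar lam x θ * Y θ ∂(surfaceMeasure d) := by
    refine integral_congr_ae ?_
    filter_upwards [toL2Sphere_ae_eq d Y] with θ hθ
    rw [hθ]
  have hpos : 0 < (((d : ℂ) - 1) / 2 - Complex.I * lam).re := by
    have : (((d : ℂ) - 1) / 2 - Complex.I * lam).re = ((d : ℝ) - 1) / 2 := by
      rw [show ((d : ℂ) - 1) / 2 = ((((d : ℝ) - 1) / 2 : ℝ) : ℂ) by push_cast; rfl]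
      simp
    rw [this]; linarith
  rw [h1]
  have h2 : ∀ θ, coulombPlaneWave d hbar lam x θ = coulombPlaneWave d hbar lam (‖x‖ • ω.1) θ := by
    intro θ; rw [← hx]
  simp only [h2, coulombPlaneWave_eq d hbar lam (norm_nonneg x), mul_assoc (_ * _) (olverM _ _ _)]
  rw [integral_const_mul, integral_olverM_mul_sphericalHarmonic hd hY,
    risingFac_eq_Gamma_div hpos,
    show ((d : ℂ) - 1) / 2 - Complex.I * lam + ℓ = ((d : ℂ) - 1) / 2 + ℓ - Complex.I * lam by ring,
    show 2 * (Complex.I * ‖x‖ / (hbar ^ 2 * lam)) = 2 * Complex.I * ‖x‖ / (hbar ^ 2 * lam) by ring]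
  push_cast
  ring

/-! ### The hyperbolic Poisson operator -/

/-- For `q < 1/2` the argument lies in the unit disc and this is Pfaff's transformation. Otherwise
the defining continuation of `olverF` already returns to the argument `q`, and Euler's
transformation finishes. -/
lemma olverF_eq_gauss (a b c : ℂ) {q : ℝ} (hq : q ∈ Set.Ioo (0 : ℝ) 1) :
    olverF (c - a) b c ((-q / (1 - q) : ℝ) : ℂ) =
      (1 - q) ^ b * Complex.regularizedGaussHGFun a b c q := by
  have hq0 := hq.1
  have hq1 : 0 < 1 - q := by linarith [hq.2]
  have h1 : (1 : ℂ) - q ≠ 0 := by exact_mod_cast hq1.ne'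
  have hn : ‖((-q / (1 - q) : ℝ) : ℂ)‖ = q / (1 - q) := by
    rw [Complex.norm_real, neg_div, norm_neg, Real.norm_of_nonneg (by positivity)]
  rw [olverF]
  split_ifs with h
  · rw [hn, div_lt_one hq1] at h
    rw [gauss_pfaff a b c (q := (q : ℂ))
        (by rw [Complex.norm_real, Real.norm_of_nonneg hq0.le]; linarith),
      ← mul_assoc, ← Complex.cpow_add _ _ h1, add_neg_cancel, Complex.cpow_zero, one_mul]
    push_cast
    rfl
  · have e1 : 1 - ((-q / (1 - q) : ℝ) : ℂ) = (1 - (q : ℂ))⁻¹ := by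
      push_cast; field_simp; ring
    have e2 : ((-q / (1 - q) : ℝ) : ℂ) / (((-q / (1 - q) : ℝ) : ℂ) - 1) = q := by
      rw [← neg_sub 1, e1]; push_cast; field_simp
    have e3 : ((1 : ℂ) - q)⁻¹ ^ (-(c - a)) = (1 - q) ^ (c - a) := by
      have harg : ((1 : ℂ) - q).arg ≠ Real.pi := by
        rw [show (1 : ℂ) - q = ((1 - q : ℝ) : ℂ) by push_cast; rfl,
          Complex.arg_ofReal_of_nonneg hq1.le]
        exact Real.pi_ne_zero.symm
      rw [Complex.inv_cpow _ _ harg, Complex.cpow_neg, inv_inv]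
    rw [e1, e2, e3, gauss_euler a b c hq, ← mul_assoc, ← Complex.cpow_add _ _ h1]
    congr 2
    ring

/-- Only the exponents `ℓ + 2k` of the binomial series survive. Splitting `(s)_(ℓ + 2k)` by
duplication yields the two half parameters, and its `4 ^ k` cancels against the moment. -/
lemma integral_cpow_mul_sphericalHarmonic {d ℓ : ℕ} (hd : 2 ≤ d) {Y : C(USphere d, ℂ)}
    (hY : IsSphericalHarmonic d ℓ Y) (ω : USphere d) (s : ℂ) {w : ℝ} (hw0 : 0 ≤ w) (hw : w < 1) :
    ∫ θ : USphere d, (1 - (w : ℂ) * ((inner ℝ ω.1 θ.1 : ℝ) : ℂ)) ^ (-s) * Y θ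
      ∂(surfaceMeasure d) =
      ((2 * Real.pi ^ ((d : ℝ) / 2) : ℝ) : ℂ) * risingFac s ℓ * (w / 2) ^ ℓ *
        Complex.regularizedGaussHGFun ((s + ℓ) / 2) ((s + ℓ + 1) / 2) ((d : ℂ) / 2 + ℓ) (w ^ 2) *
          Y ω := by
  have hwn : ‖(w : ℂ)‖ = w := by rw [Complex.norm_real, Real.norm_of_nonneg hw0]
  have hser := hasSum_integral_series
    (c := fun n => risingFac s n / n.factorial * (w : ℂ) ^ n)
    (continuous_inner_sphere ω) (ρ := 1) (fun θ => by
      rw [Complex.norm_real, Real.norm_eq_abs]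
      exact abs_inner_sphere_le_one ω θ)
    (by simpa only [one_pow, mul_one] using
      (summable_norm_binomial_and_hasSum s (q := (w : ℂ)) (by rwa [hwn])).1) Y
  have hl : ∀ θ : USphere d, (1 - (w : ℂ) * ((inner ℝ ω.1 θ.1 : ℝ) : ℂ)) ^ (-s) =
      ∑' n : ℕ, risingFac s n / n.factorial * (w : ℂ) ^ n *
        ((inner ℝ ω.1 θ.1 : ℝ) : ℂ) ^ n := by
    intro θ
    have hlt : ‖(w : ℂ) * ((inner ℝ ω.1 θ.1 : ℝ) : ℂ)‖ < 1 := by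
      rw [norm_mul, hwn, Complex.norm_real, Real.norm_eq_abs]
      have := abs_inner_sphere_le_one ω θ
      nlinarith
    rw [← (summable_norm_binomial_and_hasSum s hlt).2.tsum_eq]
    simp only [mul_pow, mul_assoc]
  simp only [hl]
  refine hser.unique ?_
  have hinj : Function.Injective fun k : ℕ => ℓ + 2 * k := fun i j h => by
    simp only at h; omega
  rw [← hinj.hasSum_iff]
  · have h2 := ((hasSum_gauss ((s + ℓ) / 2) ((s + ℓ + 1) / 2) ((d : ℂ) / 2 + ℓ)
      (z := (w : ℂ) ^ 2) (by
        rw [norm_pow, hwn]; exact pow_lt_one₀ hw0 hw (by norm_num))).mul_left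
      (((2 * Real.pi ^ ((d : ℝ) / 2) : ℝ) : ℂ) * risingFac s ℓ * (w / 2) ^ ℓ)).mul_right (Y ω)
    refine h2.congr_fun fun k => ?_
    rw [Function.comp_apply, hY.integral_inner_pow (by omega) ω k]
    have e2 : Complex.Gamma ((d : ℂ) / 2 + ℓ + k) =
        (Real.Gamma ((d : ℝ) / 2 + ℓ + k) : ℂ) := by
      rw [← Complex.Gamma_ofReal]; congr 1; push_cast; ring
    have hf : ((ℓ + 2 * k).factorial : ℂ) ≠ 0 := by exact_mod_cast (ℓ + 2 * k).factorial_ne_zero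
    rw [e2, risingFac_add, risingFac_two_mul]
    push_cast
    rw [pow_add, pow_add, div_pow, pow_mul, pow_mul, show (2 : ℂ) ^ 2 = 4 by norm_num]
    field_simp
  · intro n hn
    rw [hY.integral_inner_pow_eq_zero (by omega) ω, mul_zero]
    rintro k rfl
    exact hn ⟨k, rfl⟩

lemma norm_sub_sq_sphere {d : ℕ} (r : ℝ) (ω θ : USphere d) :
    ‖r • ω.1 - θ.1‖ ^ 2 = 1 + r ^ 2 - 2 * r * inner ℝ ω.1 θ.1 := by
  rw [norm_sub_sq_real, norm_smul, real_inner_smul_left, mul_pow, Real.norm_eq_abs, sq_abs]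
  simp
  ring

/-- Rests on `|u - θ|² = (1 + r²)(1 - w t)` with `w = 2r / (1 + r²)`; nonnegativity of the real
factors permits splitting the complex power. -/
lemma hyperbolicPlaneWave_eq {d : ℕ} (lam : ℝ) (u : HypSpace d) (ω θ : USphere d) {r : ℝ}
    (hr0 : 0 ≤ r) (hr1 : r < 1) (hu : u.1 = r • ω.1) :
    hyperbolicPlaneWave d lam u θ =
      (((1 - r ^ 2) / (1 + r ^ 2) : ℝ) : ℂ) ^ (((d : ℂ) - 1) / 2 - Complex.I * lam) *
      (1 - ((2 * r / (1 + r ^ 2) : ℝ) : ℂ) * ((inner ℝ ω.1 θ.1 : ℝ) : ℂ)) ^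
        (-(((d : ℂ) - 1) / 2 - Complex.I * lam)) := by
  have hn : ‖u.1‖ = r := by rw [hu, norm_smul, Real.norm_of_nonneg hr0]; simp
  have hw : 2 * r / (1 + r ^ 2) < 1 := by
    rw [div_lt_one (by positivity)]; nlinarith [sq_pos_of_pos (sub_pos.2 hr1)]
  have hw0 : 0 ≤ 2 * r / (1 + r ^ 2) := by positivity
  have hpos : 0 < 1 - 2 * r / (1 + r ^ 2) * inner ℝ ω.1 θ.1 := by
    have := (abs_le.1 (abs_inner_sphere_le_one ω θ)).2
    nlinarith
  have hr2 : 0 ≤ 1 - r ^ 2 := by nlinarith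
  rw [hyperbolicPlaneWave, hn, hu, norm_sub_sq_sphere,
    show (1 - r ^ 2) / (1 + r ^ 2 - 2 * r * inner ℝ ω.1 θ.1) =
      (1 - r ^ 2) / (1 + r ^ 2) * (1 - 2 * r / (1 + r ^ 2) * inner ℝ ω.1 θ.1)⁻¹ by
        have : 1 + r ^ 2 - 2 * r * inner ℝ ω.1 θ.1 =
          (1 + r ^ 2) * (1 - 2 * r / (1 + r ^ 2) * inner ℝ ω.1 θ.1) := by
          field_simp
        rw [this, div_mul_eq_div_div, div_eq_mul_inv _ (1 - _)],
    Complex.ofReal_mul, Complex.mul_cpow_ofReal_nonneg (by positivity) (by positivity)]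
  congr 1
  rw [Complex.ofReal_inv, Complex.inv_cpow _ _ (by
    rw [Complex.arg_ofReal_of_nonneg hpos.le]; exact Real.pi_ne_zero.symm), ← Complex.cpow_neg]
  push_cast
  rfl

lemma hyperbolicPoisson_eq_integral {d : ℕ} (lam : ℝ) (Y : C(USphere d, ℂ)) (u : HypSpace d) :
    hyperbolicPoisson d lam (toL2Sphere d Y) u =
      ∫ θ, hyperbolicPlaneWave d lam u θ * Y θ ∂(surfaceMeasure d) := by
  refine integral_congr_ae ?_
  filter_upwards [toL2Sphere_ae_eq d Y] with θ hθ
  rw [hθ]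

/-- The hyperbolic Poisson operator on spherical harmonics, in terms of the Gauss function. -/
lemma hyperbolicPoisson_eq_gauss {d ℓ : ℕ} (hd : 2 ≤ d) (lam : ℝ) {Y : C(USphere d, ℂ)}
    (hY : IsSphericalHarmonic d ℓ Y) (u : HypSpace d) (ω : USphere d) {r : ℝ}
    (hr0 : 0 < r) (hr1 : r < 1) (hu : u.1 = r • ω.1) :
    hyperbolicPoisson d lam (toL2Sphere d Y) u =
      ((2 * Real.pi ^ ((d : ℝ) / 2) : ℝ) : ℂ) *
        risingFac (((d : ℂ) - 1) / 2 - Complex.I * lam) ℓ * (r : ℂ) ^ ℓ *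
        ((1 - r ^ 2 : ℝ) : ℂ) ^ (((d : ℂ) - 1) / 2 - Complex.I * lam) *
        Complex.regularizedGaussHGFun (((d : ℂ) - 1) / 2 - Complex.I * lam + ℓ)
          (1 / 2 - Complex.I * lam) ((d : ℂ) / 2 + ℓ) ((r ^ 2 : ℝ) : ℂ) * Y ω := by
  set s : ℂ := ((d : ℂ) - 1) / 2 - Complex.I * lam with hs
  have hw : 2 * r / (1 + r ^ 2) < 1 := by
    rw [div_lt_one (by positivity)]; nlinarith [sq_pos_of_pos (sub_pos.2 hr1)]
  have hq : r ^ 2 ∈ Set.Ioo (0 : ℝ) 1 := ⟨by positivity, by nlinarith⟩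
  have hq1 : 0 < 1 - r ^ 2 := by linarith [hq.2]
  rw [hyperbolicPoisson_eq_integral]
  simp only [hyperbolicPlaneWave_eq lam u ω _ hr0.le hr1 hu, mul_assoc]
  rw [integral_const_mul, integral_cpow_mul_sphericalHarmonic hd hY ω _ (by positivity) hw, ← hs]
  -- This identifies the second upper parameter with the one required by the quadratic
  -- transformation for `s + ℓ` and `c = d/2 + ℓ`. Its factor `(1 + r²) ^ (-(s + ℓ))` on the other
  -- side equals the one coming from the plane wave and from `(w/2) ^ ℓ`.
  have e1 : 1 / 2 - Complex.I * lam = s + ℓ + 1 - ((d : ℂ) / 2 + ℓ) := by rw [hs]; ring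
  have hq0 : ((1 + r ^ 2 : ℝ) : ℂ) ≠ 0 := by
    exact Complex.ofReal_ne_zero.2 (by positivity)
  have e2 : (((2 * r / (1 + r ^ 2) : ℝ) : ℂ)) ^ 2 =
      4 * ((r ^ 2 : ℝ) : ℂ) / (1 + ((r ^ 2 : ℝ) : ℂ)) ^ 2 := by
    push_cast; rw [div_pow]; ring
  have e3 : (((1 - r ^ 2) / (1 + r ^ 2) : ℝ) : ℂ) ^ s =
      ((1 - r ^ 2 : ℝ) : ℂ) ^ s * ((1 + r ^ 2 : ℝ) : ℂ) ^ (-s) := by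
    rw [div_eq_mul_inv, Complex.ofReal_mul,
      Complex.mul_cpow_ofReal_nonneg hq1.le (by positivity), Complex.ofReal_inv,
      Complex.inv_cpow _ _ (by
        rw [Complex.arg_ofReal_of_nonneg (by positivity)]; exact Real.pi_ne_zero.symm),
      ← Complex.cpow_neg]
  have e4 : (((2 * r / (1 + r ^ 2) : ℝ) : ℂ) / 2) ^ ℓ =
      (r : ℂ) ^ ℓ * ((1 + r ^ 2 : ℝ) : ℂ) ^ (-(ℓ : ℂ)) := by
    rw [Complex.cpow_neg, Complex.cpow_natCast, ← div_eq_mul_inv, ← div_pow]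
    congr 1
    push_cast
    ring
  rw [e1, gauss_quadratic (s + ℓ) ((d : ℂ) / 2 + ℓ) hq, e2, e3, e4, neg_add,
    show (1 : ℂ) + ((r ^ 2 : ℝ) : ℂ) = ((1 + r ^ 2 : ℝ) : ℂ) by push_cast; rfl,
    Complex.cpow_add _ _ hq0]
  ring

/-- The hyperbolic Poisson operator on spherical harmonics. -/
lemma hyperbolicPoisson_sphericalHarmonic {d ℓ : ℕ} (hd : 2 ≤ d) (lam : ℝ) {Y : C(USphere d, ℂ)}
    (hY : IsSphericalHarmonic d ℓ Y) (u : HypSpace d) (ω : USphere d) (hu0 : u.1 ≠ 0)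
    (hu : u.1 = ‖u.1‖ • ω.1) :
    hyperbolicPoisson d lam (toL2Sphere d Y) u =
        (((2 * Real.pi) ^ ((d : ℝ) / 2) : ℝ) : ℂ) *
          (Complex.Gamma (((d : ℂ) - 1) / 2 - Complex.I * lam + ℓ) /
            Complex.Gamma (((d : ℂ) - 1) / 2 - Complex.I * lam)) *
          (((2 * ‖u.1‖ / (1 - ‖u.1‖ ^ 2)) ^ (1 - (d : ℝ) / 2) : ℝ) : ℂ) *
          legendreP (-((d : ℂ) / 2 - 1 + ℓ)) (-1 / 2 + Complex.I * lam)
            ((1 + ‖u.1‖ ^ 2) / (1 - ‖u.1‖ ^ 2)) *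
          Y ω := by
  have hd2 : (2 : ℝ) ≤ d := by exact_mod_cast hd
  have hr0 : 0 < ‖u.1‖ := norm_pos_iff.2 hu0
  have hr1 : ‖u.1‖ < 1 := mem_ball_zero_iff.1 u.2
  generalize ‖u.1‖ = r at hu hr0 hr1
  have hq : r ^ 2 ∈ Set.Ioo (0 : ℝ) 1 := ⟨by positivity, by nlinarith⟩
  have hq1 : 0 < 1 - r ^ 2 := by linarith [hq.2]
  have hpos : 0 < (((d : ℂ) - 1) / 2 - Complex.I * lam).re := by
    have : (((d : ℂ) - 1) / 2 - Complex.I * lam).re = ((d : ℝ) - 1) / 2 := by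
      rw [show ((d : ℂ) - 1) / 2 = ((((d : ℝ) - 1) / 2 : ℝ) : ℂ) by push_cast; rfl]
      simp
    rw [this]; linarith
  rw [hyperbolicPoisson_eq_gauss hd lam hY u ω hr0 hr1 hu, ← risingFac_eq_Gamma_div hpos,
    legendreP]
  have x1 : ((1 + r ^ 2) / (1 - r ^ 2) + 1) / ((1 + r ^ 2) / (1 - r ^ 2) - 1) = (r ^ 2)⁻¹ := by
    have h1 : (1 + r ^ 2) / (1 - r ^ 2) + 1 = 2 / (1 - r ^ 2) := by field_simp; ring
    have h2 : (1 + r ^ 2) / (1 - r ^ 2) - 1 = 2 * r ^ 2 / (1 - r ^ 2) := by field_simp; ring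
    rw [h1, h2]
    field_simp
  have x2 : (1 - (1 + r ^ 2) / (1 - r ^ 2)) / 2 = -(r ^ 2) / (1 - r ^ 2) := by
    field_simp; ring
  have c1 : 1 - -((d : ℂ) / 2 - 1 + ℓ) = (d : ℂ) / 2 + ℓ := by ring
  have c2 : -1 / 2 + Complex.I * lam + 1 =
      (d : ℂ) / 2 + ℓ - (((d : ℂ) - 1) / 2 - Complex.I * lam + ℓ) := by ring
  have c3 : -(-1 / 2 + Complex.I * lam) = 1 / 2 - Complex.I * lam := by ring
  have p1 : (((r ^ 2)⁻¹ : ℝ) : ℂ) ^ (-((d : ℂ) / 2 - 1 + ℓ) / 2) =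
      ((r ^ ((d : ℝ) / 2 - 1) * r ^ ℓ : ℝ) : ℂ) := by
    rw [show -((d : ℂ) / 2 - 1 + ℓ) / 2 = ((-((d : ℝ) / 2 - 1 + ℓ) / 2 : ℝ) : ℂ) by push_cast; rfl,
      ← Complex.ofReal_cpow (by positivity), ← Real.rpow_natCast r ℓ, ← Real.rpow_add hr0,
      Real.inv_rpow (by positivity), ← Real.rpow_neg (by positivity), ← Real.rpow_natCast r 2,
      ← Real.rpow_mul hr0.le]
    congr 2
    push_cast
    ring
  have p2 : ((1 - r ^ 2 : ℝ) : ℂ) ^ (((d : ℂ) - 1) / 2 - Complex.I * lam) =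
      (((1 - r ^ 2) ^ ((d : ℝ) / 2 - 1) : ℝ) : ℂ) *
        ((1 - r ^ 2 : ℝ) : ℂ) ^ (1 / 2 - Complex.I * lam) := by
    rw [Complex.ofReal_cpow hq1.le, ← Complex.cpow_add _ _ (Complex.ofReal_ne_zero.2 hq1.ne')]
    congr 1
    push_cast
    ring
  -- Matches the elementary prefactors: the power of `sinh`-type quantity `2r / (1 - r²)` absorbs
  -- the `r ^ (d/2 - 1)` from the Legendre prefactor and leaves `(1 - r²) ^ (d/2 - 1)`.
  have p3 : (2 * Real.pi) ^ ((d : ℝ) / 2) * (2 * r / (1 - r ^ 2)) ^ (1 - (d : ℝ) / 2) *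
      r ^ ((d : ℝ) / 2 - 1) = 2 * Real.pi ^ ((d : ℝ) / 2) * (1 - r ^ 2) ^ ((d : ℝ) / 2 - 1) := by
    rw [Real.mul_rpow (by norm_num) Real.pi_pos.le, Real.div_rpow (by positivity) hq1.le,
      Real.mul_rpow (by norm_num) hr0.le, show 1 - (d : ℝ) / 2 = -((d : ℝ) / 2 - 1) by ring,
      Real.rpow_neg hr0.le, Real.rpow_neg hq1.le, Real.rpow_neg (by norm_num),
      Real.rpow_sub_one (by norm_num : (2 : ℝ) ≠ 0)]
    have h1 : r ^ ((d : ℝ) / 2 - 1) ≠ 0 := by positivity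
    have h2 : (1 - r ^ 2) ^ ((d : ℝ) / 2 - 1) ≠ 0 := by positivity
    have h3 : (2 : ℝ) ^ ((d : ℝ) / 2) ≠ 0 := by positivity
    field_simp
  have p3' := congrArg (fun t : ℝ => (t : ℂ)) p3
  simp only [Complex.ofReal_mul] at p3'
  rw [x1, x2, c1, c2, c3, olverF_eq_gauss _ _ _ hq, p1, p2,
    show (1 : ℂ) - ((r ^ 2 : ℝ) : ℂ) = ((1 - r ^ 2 : ℝ) : ℂ) by push_cast; rfl,
    Complex.ofReal_mul, Complex.ofReal_mul, Complex.ofReal_pow r ℓ]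
  linear_combination (-(risingFac (((d : ℂ) - 1) / 2 - Complex.I * lam) ℓ * (r : ℂ) ^ ℓ *
    ((1 - r ^ 2 : ℝ) : ℂ) ^ (1 / 2 - Complex.I * lam) *
    Complex.regularizedGaussHGFun (((d : ℂ) - 1) / 2 - Complex.I * lam + ℓ)
          (1 / 2 - Complex.I * lam) ((d : ℂ) / 2 + ℓ) ((r ^ 2 : ℝ) : ℂ) * Y ω)) * p3'

/-! ### Continuity and integrability -/

/-- The base of the power is a positive real throughout, since `|u| < 1 = |θ|`, so it stays in the
slit plane. Joint continuity, with the sphere compact, makes the integral continuous in `u`,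
including at the origin. -/
lemma continuous_hyperbolicPlaneWave (d : ℕ) (lam : ℝ) :
    Continuous fun z : HypSpace d × USphere d => hyperbolicPlaneWave d lam z.1 z.2 := by
  have hne : ∀ z : HypSpace d × USphere d, 0 < ‖z.1.1 - z.2.1‖ := by
    intro z
    rw [norm_pos_iff, sub_ne_zero]
    intro h
    have h1 : ‖z.1.1‖ < 1 := mem_ball_zero_iff.1 z.1.2
    have h2 : ‖z.2.1‖ = 1 := by simp
    rw [h, h2] at h1
    exact lt_irrefl _ h1
  unfold hyperbolicPlaneWave
  refine Continuous.cpow ?_ continuous_const fun z => ?_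
  · refine Complex.continuous_ofReal.comp (Continuous.div (by fun_prop) (by fun_prop) fun z => ?_)
    exact (pow_pos (hne z) 2).ne'
  · left
    have h1 : ‖z.1.1‖ < 1 := mem_ball_zero_iff.1 z.1.2
    have h2 : 0 < 1 - ‖z.1.1‖ ^ 2 := by nlinarith [norm_nonneg z.1.1]
    rw [Complex.ofReal_re]
    exact div_pos h2 (pow_pos (hne z) 2)

lemma continuous_hyperbolicPoisson (d : ℕ) (lam : ℝ) (Y : C(USphere d, ℂ)) :
    Continuous (hyperbolicPoisson d lam (toL2Sphere d Y)) := by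
  have : LocallyCompactSpace (HypSpace d) :=
    (Metric.isOpen_ball (x := (0 : EuclideanSpace ℝ (Fin d))) (ε := 1)).locallyCompactSpace
  have h := continuous_parametric_integral_of_continuous (μ := surfaceMeasure d)
    (f := fun (u : HypSpace d) (θ : USphere d) => hyperbolicPlaneWave d lam u θ * Y θ)
    ((continuous_hyperbolicPlaneWave d lam).mul (Y.continuous.comp continuous_snd))
    (s := Set.univ) isCompact_univ
  simp only [Measure.restrict_univ] at h
  convert! h using 1
  funext u
  exact hyperbolicPoisson_eq_integral lam Y u

lemma integrable_mul_toL2Sphere {d : ℕ} {f : USphere d → ℂ} (hf : Continuous f)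
    (Y : C(USphere d, ℂ)) :
    Integrable (fun θ => f θ * toL2Sphere d Y θ) (surfaceMeasure d) := by
  refine (integrable_of_continuous_sphere (hf.mul Y.continuous)).congr ?_
  filter_upwards [toL2Sphere_ae_eq d Y] with θ hθ
  rw [hθ, Pi.mul_apply]

end

theorem mainTheorem9 (d : ℕ) (hd : 2 ≤ d) (hbar lam : ℝ) (hhbar : 0 < hbar) (hlam : lam ≠ 0)
    (ℓ : ℕ) (Y : C(USphere d, ℂ)) (hY : IsSphericalHarmonic d ℓ Y) :
    -- the integrals defining both Poisson operators converge
    (∀ x : EuclideanSpace ℝ (Fin d),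
      Integrable (fun θ => coulombPlaneWave d hbar lam x θ * toL2Sphere d Y θ)
        (surfaceMeasure d)) ∧
    (∀ u : HypSpace d,
      Integrable (fun θ => hyperbolicPlaneWave d lam u θ * toL2Sphere d Y θ)
        (surfaceMeasure d)) ∧
    -- the Coulomb Poisson operator, with `x = |x| ω`
    (∀ (x : EuclideanSpace ℝ (Fin d)) (ω : USphere d), x = ‖x‖ • ω.1 →
      coulombPoisson d hbar lam (toL2Sphere d Y) x =
        ((coulombConst d hbar lam * (2 : ℝ) ^ ((d : ℝ) - 1) *
            Real.pi ^ (((d : ℝ) - 1) / 2) : ℝ) : ℂ) *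
          Complex.Gamma (((d : ℂ) - 1) / 2 + ℓ - Complex.I * lam) /
          Complex.Gamma (((d : ℂ) - 1) / 2 - Complex.I * lam) *
          (2 * Complex.I * ‖x‖ / (hbar ^ 2 * lam)) ^ ℓ *
          Complex.exp (Complex.I * ‖x‖ / (hbar ^ 2 * lam)) *
          olverM (((d : ℂ) - 1) / 2 + ℓ - Complex.I * lam) ((d : ℂ) - 1 + 2 * ℓ)
            (-(2 * Complex.I * ‖x‖ / (hbar ^ 2 * lam))) *
          Y ω) ∧
    -- the hyperbolic Poisson operator away from the origin, with `u = |u| ω`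
    (∀ (u : HypSpace d) (ω : USphere d), u.1 ≠ 0 → u.1 = ‖u.1‖ • ω.1 →
      hyperbolicPoisson d lam (toL2Sphere d Y) u =
        (((2 * Real.pi) ^ ((d : ℝ) / 2) : ℝ) : ℂ) *
          (Complex.Gamma (((d : ℂ) - 1) / 2 - Complex.I * lam + ℓ) /
            Complex.Gamma (((d : ℂ) - 1) / 2 - Complex.I * lam)) *
          (((2 * ‖u.1‖ / (1 - ‖u.1‖ ^ 2)) ^ (1 - (d : ℝ) / 2) : ℝ) : ℂ) *
          legendreP (-((d : ℂ) / 2 - 1 + ℓ)) (-1 / 2 + Complex.I * lam)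
            ((1 + ‖u.1‖ ^ 2) / (1 - ‖u.1‖ ^ 2)) *
          Y ω) ∧
    -- at the origin the last formula is understood by continuous extension
    Continuous (hyperbolicPoisson d lam (toL2Sphere d Y)) := by
  exact ⟨fun x => integrable_mul_toL2Sphere (continuous_coulombPlaneWave d hbar lam x) Y,
    fun u => integrable_mul_toL2Sphere
      ((continuous_hyperbolicPlaneWave d lam).comp (Continuous.prodMk_right u)) Y,
    fun x ω hx => coulombPoisson_sphericalHarmonic hd hbar lam hY x ω hx,
    fun u ω hu0 hu => hyperbolicPoisson_sphericalHarmonic hd lam hY u ω hu0 hu,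
    continuous_hyperbolicPoisson d lam Y⟩
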